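/- **Setting.** Let $\mathcal S,\mathcal A$ be finite sets, $\mathrm P(\cdot\mid s,a)$ a transition kernel on $\mathcal S$, $r:\mathcal S\times\mathcal A\to[0,1]$ a deterministic reward, $\gamma\in(0,1)$, $\lambda>0$, $\pi_b(\cdot\mid s)$ a behavior policy, and $\phi:\mathcal S\times\mathcal A\to\mathbb R^d$ a feature map. For $\theta\in\mathbb R^d$ put $Q_\theta(s,a)=\phi(s,a)^\top\theta$, $V_\theta^\lambda(s)=\lambda\log\sum_a e^{Q_\theta(s,a)/\lambda}$ and $\pi_\theta^\lambda(a\mid s)\propto e^{Q_\theta(s,a)/\lambda}$. Let $\bar{\mathrm P}$ be the transition kernel on $\mathcal S\times\mathcal A\times\mathcal S$ of $z_t=(s_t,a_t,s_{t+1})$ when $a_t\sim\pi_b(\cdot\mid s_t)$, $s_{t+1}\sim\mathrm P(\cdot\mid s_t,a_t)$, and let $\mu$ be its stationary distribution. Q-learning starts from a deterministic $\theta_0\in\mathbb R^d$ and runs $$\theta_{t+1}=\theta_t+\alpha_t\,\phi(s_t,a_t)\big(r(s_t,a_t)+\gamma V^\lambda_{\theta_t}(s_{t+1})-\phi(s_t,a_t)^\top\theta_t\big).$$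 Let $\theta^\star$ solve $\Pi_\mu(r+\gamma \mathrm P V^\lambda_{\theta^\star}-Q_{\theta^\star})=0$, where $\Pi_\mu$ is the orthogonal projection in $L^2(\mu)$ onto the span of the $d$ coordinate functions of $\phi$. Put $\epsilon_{\max}=1+(1+\gamma)\|\theta^\star\|+\gamma\lambda\log|\mathcal A|$, $C_\xi=\max(2\epsilon_{\max}^2,\,8(1+\gamma)^2)$, $C_\omega=\sum_{j\ge0}\alpha_j^2$, $C_1=C_\xi^2t_{\mathrm{mix}}^2/\kappa^2$, $C_2=t_{\mathrm{mix}}^2C_\xi^2C_\omega$, where $t_{\mathrm{mix}}$ and $\kappa$ are as follows. **Assumptions** (A1 being the finiteness of $\mathcal S,\mathcal A$ and $r\in[0,1]$). (A2) There is an integer $t_{\mathrm{mix}}\ge1$ with $d_{\mathrm{tv}}(\bar{\mathrm P}^t(\cdot\mid z),\mu)\le(1/4)^{\lfloor t/t_{\mathrm{mix}}\rfloor}$ for all $t\in\mathbb N$ and all $z$, and $(z_t)$ is a Markov chain with kernel $\bar{\mathrm P}$ and $z_0\sim\mu$. (A3) $\alpha_t=c_0/(t+k_0)^\omega$ with $c_0,k_0>0$,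 $\omega\in(1/2,1)$, $k_0^{1-\omega}\ge 32/(\kappa c_0)$ and $\alpha_0\le c\,\kappa/\max(p^2C_2,1)$. (A4) $\|\phi(s,a)\|\le1$ for all $(s,a)$ and, for some $\kappa>0$ and all $\theta$, $\mathsf E_\mu[\phi(s,a)\phi(s,a)^\top]-\gamma^2\,\mathsf E_{s\sim\mu,\,a\sim\pi_\theta^\lambda(\cdot\mid s)}[\phi(s,a)\phi(s,a)^\top]\succeq\kappa I$. **Theorem 1.** There are absolute constants $c,C>0$ such that, for every $p\ge2$ and every instance satisfying A1–A4 with this $c$ and $p$, and for every integer $t>0$, with $$C_M=C\max\Big(\frac{\|\theta_0-\theta^\star\|^4}{p^4\alpha_0^2},\;C_1,\;\frac{C_2^2}{\kappa^2}\Big),$$ the last iterate satisfies $$\mathsf E^{2/p}\big[\|\theta_{t+1}-\theta^\star\|^{2p}\big]\le C_M\,p^4\alpha_t^2 .$$ Consequently, for the same $t$ and $p$, $$\mathsf E^{1/p}\big[\|\theta_{t+1}-\theta^\star\|^{p}\big]\le C_M^{1/4}\,c_0^{1/2}\,p\,t^{-\omega/2},\qquad \mathsf P\big(\|\theta_{t+1}-\theta^\star\|\ge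 e\,C_M^{1/4}\,p\,\alpha_t^{1/2}\big)\le e^{-2p}.$$ -/

import Mathlib

open MeasureTheory

namespace SoftQ

noncomputable section

/-- Parameter space `ℝ^d` with the Euclidean norm. -/
abbrev Param (d : ℕ) : Type := EuclideanSpace ℝ (Fin d)

/-- Observations `z = (s, a, s')`. -/
abbrev Obs (S A : Type*) : Type _ := S × A × S

/-- Data of entropy-regularized Q-learning with linear function approximation: a finite discounted
Markov decision process with deterministic rewards in `[0,1]`, a temperature `lam`, a behavior
policy and a feature map. -/
structure Model (S A : Type*) [Fintype S] [Fintype A] (d : ℕ) where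
  /-- transition probabilities `P(s' ∣ s, a)` -/
  P : S → A → S → ℝ
  P_mem : ∀ s a, P s a ∈ stdSimplex ℝ S
  /-- reward -/
  r : S → A → ℝ
  r_mem : ∀ s a, r s a ∈ Set.Icc (0 : ℝ) 1
  /-- discount factor -/
  γ : ℝ
  γ_mem : γ ∈ Set.Ioo (0 : ℝ) 1
  /-- temperature -/
  lam : ℝ
  lam_pos : 0 < lam
  /-- behavior policy `π_b(a ∣ s)` -/
  πb : S → A → ℝ
  πb_mem : ∀ s, πb s ∈ stdSimplex ℝ A
  /-- feature map -/
  φ : S → A → Param d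

/-- Total variation distance of two (mass functions of) probability measures on a finite set:
half of the supremum of `|μ(f) - ν(f)|` over `f` with `‖f‖_∞ ≤ 1`. -/
def tvDist {Z : Type*} [Fintype Z] (μ ν : Z → ℝ) : ℝ :=
  (1 / 2) * sSup ((fun f : Z → ℝ => |∑ z, μ z * f z - ∑ z, ν z * f z|) '' {f | ∀ z, |f z| ≤ 1})

/-- `μ` is a stationary distribution of the stochastic matrix `K`. -/
def IsStationary {Z : Type*} [Fintype Z] (K : Matrix Z Z ℝ) (μ : Z → ℝ) : Prop :=
  μ ∈ stdSimplex ℝ Z ∧ Matrix.vecMul μ K = μ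

/-- Uniform geometric ergodicity with mixing time `tmix` (the division is that of `ℕ`,
that is, the floor of the quotient). -/
def IsUGE {Z : Type*} [Fintype Z] [DecidableEq Z] (K : Matrix Z Z ℝ) (μ : Z → ℝ) (tmix : ℕ) :
    Prop :=
  0 < tmix ∧ ∀ (t : ℕ) (z : Z), tvDist ((K ^ t) z) μ ≤ (1 / 4 : ℝ) ^ (t / tmix)

/-- `z` is a time-homogeneous Markov chain on a finite set with initial distribution `μ` and
transition matrix `K`. -/
structure IsMarkovChain {Ω : Type*} [MeasurableSpace Ω] (ℙ : Measure Ω) {Z : Type*}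
    (μ : Z → ℝ) (K : Matrix Z Z ℝ) (z : ℕ → Ω → Z) : Prop where
  measurable : ∀ (n : ℕ) (x : Z), MeasurableSet (z n ⁻¹' {x})
  law : ∀ (n : ℕ) (x : ℕ → Z),
    ℙ.real {ω | ∀ i ≤ n, z i ω = x i} = μ (x 0) * ∏ i ∈ Finset.range n, K (x i) (x (i + 1))

/-- Step sizes `α_t = c₀ / (t + k₀)^ω`. -/
def stepSize (c₀ k₀ ω : ℝ) (t : ℕ) : ℝ := c₀ / ((t : ℝ) + k₀) ^ ω

/-- `C_ω = ∑_{j ≥ 0} α_j²` (a convergent series when `ω > 1/2` and `k₀ > 0`). -/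
def Comega (c₀ k₀ ω : ℝ) : ℝ := ∑' j : ℕ, stepSize c₀ k₀ ω j ^ 2

namespace Model

variable {S A : Type*} [Fintype S] [Fintype A] {d : ℕ} (M : Model S A d)

/-- Transition matrix of the observation chain `z_t = (s_t, a_t, s_{t+1})` under the behavior
policy. -/
def obsKernel [DecidableEq S] : Matrix (Obs S A) (Obs S A) ℝ :=
  Matrix.of fun z₁ z₂ =>
    if z₂.1 = z₁.2.2 then M.πb z₂.1 z₂.2.1 * M.P z₂.1 z₂.2.1 z₂.2.2 else 0

/-- `Q_θ(s,a) = φ(s,a)ᵀ θ`. -/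
def Q (θ : Param d) (s : S) (a : A) : ℝ := ∑ k, M.φ s a k * θ k

/-- Soft value function `V_θ^λ(s) = λ log ∑_a exp(Q_θ(s,a)/λ)`. -/
def V (θ : Param d) (s : S) : ℝ := M.lam * Real.log (∑ a, Real.exp (M.Q θ s a / M.lam))

/-- Soft-greedy policy. -/
def softPolicy (θ : Param d) (s : S) (a : A) : ℝ :=
  Real.exp (M.Q θ s a / M.lam) / ∑ a', Real.exp (M.Q θ s a' / M.lam)

/-- `F(θ, z) = φ(s,a) (r(s,a) + γ V_θ^λ(s') - Q_θ(s,a))` for `z = (s, a, s')`. -/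
def F (θ : Param d) (z : Obs S A) : Param d :=
  (M.r z.1 z.2.1 + M.γ * M.V θ z.2.2 - M.Q θ z.1 z.2.1) • M.φ z.1 z.2.1

/-- Q-learning iterates along a trajectory `z`, started from `θ₀`. -/
def iterate (α : ℕ → ℝ) (θ₀ : Param d) (z : ℕ → Obs S A) : ℕ → Param d
  | 0 => θ₀
  | t + 1 => iterate α θ₀ z t + α t • M.F (iterate α θ₀ z t) (z t)

/-- `φ(s,a) φ(s,a)ᵀ`. -/
def featGram (s : S) (a : A) : Matrix (Fin d) (Fin d) ℝ :=
  Matrix.of fun i j => M.φ s a i * M.φ s a j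

/-- Feature covariance under the behavior distribution, `E_μ[φ(s,a) φ(s,a)ᵀ]`. -/
def covBehavior (μ : Obs S A → ℝ) : Matrix (Fin d) (Fin d) ℝ :=
  ∑ z, μ z • M.featGram z.1 z.2.1

/-- Feature covariance under the soft-greedy policy,
`E_{s ∼ μ, a ∼ π_θ^λ(· ∣ s)}[φ(s,a) φ(s,a)ᵀ]`. -/
def covSoft (μ : Obs S A → ℝ) (θ : Param d) : Matrix (Fin d) (Fin d) ℝ :=
  ∑ z, μ z • ∑ a, M.softPolicy θ z.1 a • M.featGram z.1 a

/-- Condition on the features: they are bounded by `1`, and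
`Σ_φ^{π_b} - γ² Σ_φ^θ ⪰ κ I` for all `θ`, where `κ > 0`. -/
def FeatureCondition (μ : Obs S A → ℝ) (κ : ℝ) : Prop :=
  0 < κ ∧ (∀ s a, ‖M.φ s a‖ ≤ 1) ∧
    ∀ θ : Param d, (M.covBehavior μ - M.γ ^ 2 • M.covSoft μ θ
      - κ • (1 : Matrix (Fin d) (Fin d) ℝ)).PosSemidef

/-- `span(Φ)`, the span of the columns of the feature matrix, inside `ℝ^{S × A}`. -/
def featSpan : Submodule ℝ (S → A → ℝ) :=
  Submodule.span ℝ (Set.range fun (k : Fin d) (s : S) (a : A) => M.φ s a k)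

/-- `w` is the orthogonal projection of `v` onto `span(Φ)` with respect to the inner product
`⟨u, v⟩_μ = E_μ[u(s,a) v(s,a)]`. -/
def IsProjection (μ : Obs S A → ℝ) (v w : S → A → ℝ) : Prop :=
  w ∈ M.featSpan ∧
    ∀ u ∈ M.featSpan, ∑ z, μ z * ((v z.1 z.2.1 - w z.1 z.2.1) * u z.1 z.2.1) = 0

/-- Soft Bellman residual `r + γ P V_θ^λ - Q_θ`. -/
def residual (θ : Param d) (s : S) (a : A) : ℝ :=
  M.r s a + M.γ * ∑ s', M.P s a s' * M.V θ s' - M.Q θ s a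

/-- The projected soft Bellman equation `Π_μ (r + γ P V_θ^λ - Q_θ) = 0`. -/
def SolvesProjectedBellman (μ : Obs S A → ℝ) (θ : Param d) : Prop :=
  M.IsProjection μ (M.residual θ) 0

/-- `ε_max = 1 + (1 + γ) ‖θ⋆‖ + γ λ log |A|`. -/
def epsMax (θs : Param d) : ℝ :=
  1 + (1 + M.γ) * ‖θs‖ + M.γ * M.lam * Real.log (Fintype.card A)

/-- `C_ξ = 2 ε_max² ∨ 8 (1 + γ)²`. -/
def Cxi (θs : Param d) : ℝ := max (2 * M.epsMax θs ^ 2) (8 * (1 + M.γ) ^ 2)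

/-- `C₁ = C_ξ² t_mix² / κ²`. -/
def C1 (θs : Param d) (tmix : ℕ) (κ : ℝ) : ℝ := M.Cxi θs ^ 2 * (tmix : ℝ) ^ 2 / κ ^ 2

/-- `C₂ = t_mix² C_ξ² C_ω`. -/
def C2 (θs : Param d) (tmix : ℕ) (c₀ k₀ ω : ℝ) : ℝ :=
  (tmix : ℝ) ^ 2 * M.Cxi θs ^ 2 * Comega c₀ k₀ ω

/-- `‖θ₀ - θ⋆‖⁴ / (p⁴ α₀²) ∨ C₁ ∨ C₂² / κ²`. -/
def CM (θ₀ θs : Param d) (tmix : ℕ) (κ c₀ k₀ ω p : ℝ) : ℝ :=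
  max (max (‖θ₀ - θs‖ ^ 4 / (p ^ 4 * stepSize c₀ k₀ ω 0 ^ 2)) (M.C1 θs tmix κ))
    (M.C2 θs tmix c₀ k₀ ω ^ 2 / κ ^ 2)

/-- Condition on the step sizes, with `c` the constant in the upper bound on `α₀`. -/
def StepCondition (c : ℝ) (θs : Param d) (tmix : ℕ) (κ c₀ k₀ ω p : ℝ) : Prop :=
  0 < c₀ ∧ 0 < k₀ ∧ ω ∈ Set.Ioo (1 / 2 : ℝ) 1 ∧ 32 / (κ * c₀) ≤ k₀ ^ (1 - ω) ∧
    stepSize c₀ k₀ ω 0 ≤ c * (κ / max (p ^ 2 * M.C2 θs tmix c₀ k₀ ω) 1)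

end Model

end

end SoftQ

/-! Let `x_t = θ_t - θ⋆`. The gradient of the soft value function is an average over the soft-greedy
policy, so a Cauchy–Schwarz type estimate and the feature condition make the stationary mean of the
update contract: `⟨x, E_μ F(θ⋆ + x, ·)⟩ ≤ -(κ/2)‖x‖²` (`sum_inner_F_le`).

The noise is Markovian, not a martingale difference. The kernel `∑ₖ (Kᵏ - 1 ⊗ μ)` solves the Poisson
equation and its rows have `ℓ¹` norm at most `3τ`, where `τ = t_mix`. Adding to `‖x‖²` the Poisson
solution for `v ↦ ⟨x, F x v⟩`, weighted by `2α_t`, and a shift proportional to `α_t` gives a process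
`Y_t` with conditional drift at most `-(3/4)α_t κ‖x_t‖² + O(τ α_t² b²)`, where `b² = C_ξ`
(`sum_K_lyapunov_le`).

For `p`-th moments `y ↦ y^p` is expanded to second order. The corrector can change by a relative
amount `δ = α τ b` in a single step, which is also the order of the total movement over `τ` steps.
Squaring this at every step would lose a factor `τ`, so the expansion is made once per block of `τ`
steps: the contraction is then of order `β = α τ κ`, against a second-order cost of order `p δ²`,
which is dominated when `p α τ b²` is small compared with `κ`. The shift `level * α_t` is the
resulting noise floor, of order `p τ b² α_t / κ`. As `α` loses at most a fraction `β/32` over a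
block, less than the contraction, induction in strides of `τ` gives `E Y_t^p ≤ (D α_t)^p`
(`integral_lyapunov_rpow_le`).

The smallness needed for the blocks follows from the bound on `α₀` through `C₂`, because `C_ω ≥
8α₀/κ` (`le_Comega`). The `p`-th moment and tail bounds follow from the moment of order `2p` by
Jensen and Markov. -/

namespace SoftQ

/-! ### Functions of a finite path and the Markov property -/

/-- `f` is a function of the first `n + 1` observations only. -/
def Past {Ω Z β : Type*} (z : ℕ → Ω → Z) (n : ℕ) (f : Ω → β) : Prop :=
  ∀ x y : Ω, (∀ i ≤ n, z i x = z i y) → f x = f y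

/-- The first `n + 1` observations. -/
def path {Ω Z : Type*} (z : ℕ → Ω → Z) (n : ℕ) (x : Ω) : Fin (n + 1) → Z := fun i => z i x

namespace Past

variable {Ω Z β β' : Type*} {z : ℕ → Ω → Z} {n m : ℕ}

theorem mono {f : Ω → β} (h : Past z n f) (hnm : n ≤ m) : Past z m f :=
  fun x y hxy => h x y fun i hi => hxy i (hi.trans hnm)

theorem comp {f : Ω → β} (h : Past z n f) (g : β → β') : Past z n (fun x => g (f x)) :=
  fun x y hxy => congrArg g (h x y hxy)

theorem comp₂ {β'' : Type*} {f : Ω → β} {f' : Ω → β'} (h : Past z n f) (h' : Past z n f')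
    (g : β → β' → β'') : Past z n (fun x => g (f x) (f' x)) :=
  fun x y hxy => by simp only [h x y hxy, h' x y hxy]

theorem obs (z : ℕ → Ω → Z) (hnm : n ≤ m) : Past z m (z n) := fun _ _ hxy => hxy n hnm

theorem factor [Nonempty β] {f : Ω → β} (h : Past z n f) :
    ∃ g : (Fin (n + 1) → Z) → β, ∀ x, f x = g (path z n x) := by
  classical
  obtain ⟨g, hg⟩ := (Function.factorsThrough_iff (f := path z n) f).1 (fun x y hxy => h x y
    fun i hi => congrFun hxy ⟨i, by omega⟩)
  exact ⟨g, fun x => congrFun hg x⟩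

end Past

section

variable {Ω : Type*} [MeasurableSpace Ω] {ℙ : Measure Ω} {Z : Type*} {μ : Z → ℝ} {K : Matrix Z Z ℝ} {z : ℕ → Ω → Z}

theorem IsMarkovChain.measurableSet_path (hz : IsMarkovChain ℙ μ K z) (n : ℕ)
    (y : Fin (n + 1) → Z) : MeasurableSet (path z n ⁻¹' {y}) := by
  have : path z n ⁻¹' {y} = ⋂ i : Fin (n + 1), z i ⁻¹' {y i} := by
    ext x
    simp [path, funext_iff]
  rw [this]
  exact MeasurableSet.iInter fun i => hz.measurable i (y i)

theorem IsMarkovChain.measureReal_path_inter (hz : IsMarkovChain ℙ μ K z) (n : ℕ)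
    (y : Fin (n + 1) → Z) (w : Z) :
    ℙ.real (path z n ⁻¹' {y} ∩ z (n + 1) ⁻¹' {w})
      = ℙ.real (path z n ⁻¹' {y}) * K (y (Fin.last n)) w := by
  -- The value `w` past the end of `y` lets one sequence serve in the law both at time `n` and at
  -- time `n + 1`.
  let e : ℕ → Z := fun i => if h : i < n + 1 then y ⟨i, h⟩ else w
  have h1 := hz.law n e
  have h2 := hz.law (n + 1) e
  have e1 : {x | ∀ i ≤ n, z i x = e i} = path z n ⁻¹' {y} := by
    ext x
    simp only [Set.mem_ofPred_eq, Set.mem_preimage, Set.mem_singleton_iff, funext_iff, path]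
    constructor
    · intro h i
      have := h i (by omega)
      simpa [e, Nat.le_of_lt_succ i.2] using this
    · intro h i hi
      have := h ⟨i, by omega⟩
      simpa [e, hi] using this
  have e2 : {x | ∀ i ≤ n + 1, z i x = e i} = path z n ⁻¹' {y} ∩ z (n + 1) ⁻¹' {w} := by
    rw [← e1]
    ext x
    simp only [Set.mem_ofPred_eq, Set.mem_inter_iff, Set.mem_preimage, Set.mem_singleton_iff]
    constructor
    · intro h
      exact ⟨fun i hi => h i (by omega), by simpa [e] using h (n + 1) le_rfl⟩
    · rintro ⟨h, h'⟩ i hi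
      rcases Nat.lt_or_ge n i with hni | hni
      · obtain rfl : i = n + 1 := by omega
        simpa [e] using h'
      · exact h i hni
  rw [e1] at h1
  rw [e2, Finset.prod_range_succ, ← mul_assoc, ← h1] at h2
  rw [h2]
  congr 2 <;> simp [e, Fin.last]

variable [IsProbabilityMeasure ℙ] [Fintype Z]

/-- A path of fixed length takes finitely many values, so `f` is a finite combination of indicators
of path events; this settles measurability too. -/
theorem IsMarkovChain.integrable (hz : IsMarkovChain ℙ μ K z) {n : ℕ} {f : Ω → ℝ}
    (hf : Past z n f) : Integrable f ℙ := by
  classical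
  obtain ⟨g, hg⟩ := hf.factor
  have : f = fun x => ∑ y, (path z n ⁻¹' {y}).indicator (fun _ => g y) x := by
    funext x
    rw [Finset.sum_eq_single (path z n x)]
    · simp [hg]
    · intro y _ hy
      exact Set.indicator_of_notMem (fun h => hy (by simpa using h.symm)) _
    · simp
  rw [this]
  exact integrable_finsetSum _ fun y _ =>
    (integrable_const (g y)).indicator (hz.measurableSet_path n y)

/-- The Markov property, tested against functions of the past. -/
theorem IsMarkovChain.integral_succ (hz : IsMarkovChain ℙ μ K z) {n : ℕ} {H : Ω → Z → ℝ}
    (hH : Past z n H) :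
    ∫ x, H x (z (n + 1) x) ∂ℙ = ∫ x, ∑ w, K (z n x) w * H x w ∂ℙ := by
  classical
  have hz0 : Nonempty (Z → ℝ) := ⟨fun _ => 0⟩
  obtain ⟨g, hg⟩ := hH.factor
  have hL : ∀ x, H x (z (n + 1) x) = ∑ y, ∑ w,
      (path z n ⁻¹' {y} ∩ z (n + 1) ⁻¹' {w}).indicator (fun _ => g y w) x := by
    intro x
    rw [Finset.sum_eq_single (path z n x), Finset.sum_eq_single (z (n + 1) x)]
    · simp [hg]
    · intro w _ hw
      exact Set.indicator_of_notMem (fun h => hw (by simpa using h.2.symm)) _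
    · simp
    · intro y _ hy
      exact Finset.sum_eq_zero fun w _ =>
        Set.indicator_of_notMem (fun h => hy (by simpa using h.1.symm)) _
    · simp
  have hR : ∀ x, ∑ w, K (z n x) w * H x w = ∑ y, ∑ w,
      (path z n ⁻¹' {y}).indicator (fun _ => K (y (Fin.last n)) w * g y w) x := by
    intro x
    rw [Finset.sum_eq_single (path z n x)]
    · simp [hg, path]
    · intro y _ hy
      exact Finset.sum_eq_zero fun w _ =>
        Set.indicator_of_notMem (fun h => hy (by simpa using h.symm)) _
    · simp
  have hm1 : ∀ y w, MeasurableSet (path z n ⁻¹' {y} ∩ z (n + 1) ⁻¹' {w}) := fun y w =>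
    (hz.measurableSet_path n y).inter (hz.measurable _ w)
  simp_rw [hL, hR]
  rw [integral_finsetSum _ fun y _ => integrable_finsetSum _ fun w _ =>
    (integrable_const (g y w)).indicator (hm1 y w)]
  rw [integral_finsetSum _ fun y _ => integrable_finsetSum _ fun w _ =>
    (integrable_const _).indicator (hz.measurableSet_path n y)]
  refine Finset.sum_congr rfl fun y _ => ?_
  rw [integral_finsetSum _ fun w _ => (integrable_const (g y w)).indicator (hm1 y w)]
  rw [integral_finsetSum _ fun w _ =>
    (integrable_const _).indicator (hz.measurableSet_path n y)]
  refine Finset.sum_congr rfl fun w _ => ?_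
  rw [integral_indicator (hm1 y w), integral_indicator (hz.measurableSet_path n y)]
  simp only [integral_const, smul_eq_mul, measureReal_restrict_apply_univ]
  rw [hz.measureReal_path_inter]
  ring

end

/-! ### Mixing and the Poisson equation -/

theorem sum_abs_sub_le_tvDist {Z : Type*} [Fintype Z] (μ ν : Z → ℝ) :
    ∑ z, |μ z - ν z| ≤ 2 * tvDist μ ν := by
  have hb : BddAbove ((fun f : Z → ℝ => |∑ z, μ z * f z - ∑ z, ν z * f z|) ''
      {f | ∀ z, |f z| ≤ 1}) := by
    refine ⟨∑ z, |μ z - ν z|, ?_⟩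
    rintro _ ⟨f, hf, rfl⟩
    simp only
    rw [← Finset.sum_sub_distrib]
    refine (Finset.abs_sum_le_sum_abs _ _).trans (Finset.sum_le_sum fun z _ => ?_)
    rw [← sub_mul, abs_mul]
    exact mul_le_of_le_one_right (abs_nonneg _) (hf z)
  have hs := le_csSup hb ⟨fun z => if 0 ≤ μ z - ν z then 1 else -1, fun z => by
    by_cases h : 0 ≤ μ z - ν z <;> simp [h], rfl⟩
  have : ∑ z, |μ z - ν z| = ∑ z, μ z * (if 0 ≤ μ z - ν z then 1 else -1)
      - ∑ z, ν z * (if 0 ≤ μ z - ν z then (1 : ℝ) else -1) := by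
    rw [← Finset.sum_sub_distrib]
    refine Finset.sum_congr rfl fun z _ => ?_
    split_ifs with h
    · rw [abs_of_nonneg h]; ring
    · rw [abs_of_neg (not_le.1 h)]; ring
  unfold tvDist
  rw [this]
  have := le_abs_self (∑ z, μ z * (if 0 ≤ μ z - ν z then 1 else -1)
      - ∑ z, ν z * (if 0 ≤ μ z - ν z then (1 : ℝ) else -1))
  simp only at hs
  linarith

/-- Under `k ↦ (k / τ, k % τ)` each power of `1/4` occurs exactly `τ` times, so the geometric sum
`4/3` is multiplied by `τ`. -/
theorem hasSum_pow_div (τ : ℕ) (hτ : 0 < τ) :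
    HasSum (fun k : ℕ => (1 / 4 : ℝ) ^ (k / τ)) (4 / 3 * τ) := by
  have : NeZero τ := ⟨hτ.ne'⟩
  have h1 : HasSum (fun j : ℕ => (1 / 4 : ℝ) ^ j) (4 / 3) := by
    have := hasSum_geometric_of_lt_one (r := (1 / 4 : ℝ)) (by norm_num) (by norm_num)
    norm_num at this ⊢
    exact this
  have h2 : HasSum (fun q : ℕ × Fin τ => (1 / 4 : ℝ) ^ q.1 * 1) (4 / 3 * τ) := by
    have h3 : HasSum (fun _ : Fin τ => (1 : ℝ)) τ := by
      simpa using hasSum_fintype (fun _ : Fin τ => (1 : ℝ))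
    refine h1.mul h3 ?_
    exact h1.summable.mul_of_nonneg h3.summable (fun j => by positivity) (fun j => by simp)
  have h4 := (Nat.divModEquiv τ).hasSum_iff.2 h2
  convert h4 using 1
  funext k
  simp [Nat.divModEquiv]

section

variable {Z : Type*} [Fintype Z] [DecidableEq Z] {K : Matrix Z Z ℝ} {μ : Z → ℝ} {τ : ℕ}

/-- The fundamental kernel `∑ₖ (Kᵏ - 1 ⊗ μ)` of an ergodic chain. -/
noncomputable def fundamental (K : Matrix Z Z ℝ) (μ : Z → ℝ) (v w : Z) : ℝ :=
  ∑' k : ℕ, ((K ^ k) v w - μ w)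

theorem IsUGE.sum_abs_le (h : IsUGE K μ τ) (k : ℕ) (v : Z) :
    ∑ w, |(K ^ k) v w - μ w| ≤ 2 * (1 / 4 : ℝ) ^ (k / τ) :=
  (sum_abs_sub_le_tvDist _ _).trans (by linarith [h.2 k v])

theorem IsUGE.summable_abs (h : IsUGE K μ τ) (v w : Z) :
    Summable fun k : ℕ => |(K ^ k) v w - μ w| :=
  Summable.of_nonneg_of_le (fun _ => abs_nonneg _)
    (fun k => (Finset.single_le_sum (f := fun w => |(K ^ k) v w - μ w|)
      (fun _ _ => abs_nonneg _) (Finset.mem_univ w)).trans (h.sum_abs_le k v))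
    ((hasSum_pow_div τ h.1).mul_left 2).summable

theorem IsUGE.summable (h : IsUGE K μ τ) (v w : Z) :
    Summable fun k : ℕ => ((K ^ k) v w - μ w) := (h.summable_abs v w).of_abs

theorem IsUGE.sum_abs_fundamental_le (h : IsUGE K μ τ) (v : Z) :
    ∑ w, |fundamental K μ v w| ≤ 3 * τ := by
  have h1 : ∀ w, |fundamental K μ v w| ≤ ∑' k : ℕ, |(K ^ k) v w - μ w| := fun w => by
    have := norm_tsum_le_tsum_norm (f := fun k : ℕ => ((K ^ k) v w - μ w))
      (by simpa using h.summable_abs v w)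
    simpa [fundamental] using this
  calc ∑ w, |fundamental K μ v w| ≤ ∑ w, ∑' k : ℕ, |(K ^ k) v w - μ w| :=
        Finset.sum_le_sum fun w _ => h1 w
    _ = ∑' k : ℕ, ∑ w, |(K ^ k) v w - μ w| :=
        (Summable.tsum_finsetSum fun w _ => h.summable_abs v w).symm
    _ ≤ ∑' k : ℕ, 2 * (1 / 4 : ℝ) ^ (k / τ) :=
        Summable.tsum_le_tsum (fun k => h.sum_abs_le k v)
          (summable_sum fun w _ => h.summable_abs v w)
          ((hasSum_pow_div τ h.1).mul_left 2).summable
    _ = 2 * (4 / 3 * τ) := ((hasSum_pow_div τ h.1).mul_left 2).tsum_eq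
    _ ≤ 3 * τ := by
        have : (0 : ℝ) ≤ τ := by positivity
        linarith

/-- The fundamental kernel solves the Poisson equation. -/
theorem IsUGE.sum_mul_fundamental (h : IsUGE K μ τ) (hK : ∀ v, ∑ w, K v w = 1) (v w : Z) :
    ∑ u, K v u * fundamental K μ u w
      = fundamental K μ v w - ((if v = w then 1 else 0) - μ w) := by
  -- Applying `K` shifts the series by one index; the lost term `k = 0` is the right-hand side of
  -- the Poisson equation.
  have h1 : ∑ u, K v u * fundamental K μ u w = ∑' k : ℕ, ((K ^ (k + 1)) v w - μ w) := by
    unfold fundamental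
    simp_rw [← tsum_mul_left]
    rw [← Summable.tsum_finsetSum fun u _ => (h.summable u w).mul_left _]
    refine tsum_congr fun k => ?_
    simp_rw [mul_sub, Finset.sum_sub_distrib, ← Finset.sum_mul, hK, one_mul]
    rw [pow_succ', Matrix.mul_apply]
  rw [h1]
  have h2 := (h.summable v w).tsum_eq_zero_add
  unfold fundamental
  rw [h2]
  simp [Matrix.one_apply]

end

/-! ### Abstract stochastic approximation: corrector and one-step drift -/

/-- A stochastic approximation recursion with field `F`, centered at its root `0`, driven by an
ergodic chain with transition matrix `K` and Poisson kernel `R`, together with step sizes small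
enough for moments of order `p`. -/
structure SASetup {E Z : Type*} [NormedAddCommGroup E] [InnerProductSpace ℝ E] [Fintype Z]
    [DecidableEq Z] (F : E → Z → E) (K : Matrix Z Z ℝ) (μ : Z → ℝ) (R : Z → Z → ℝ)
    (α : ℕ → ℝ) (b κ p : ℝ) (τ : ℕ) : Prop where
  growth : ∀ x v, ‖F x v‖ ≤ b * (1 + ‖x‖)
  lip : ∀ x y v, ‖F x v - F y v‖ ≤ b * ‖x - y‖
  drift : ∀ x, ∑ v, μ v * inner ℝ x (F x v) ≤ -(κ / 2) * ‖x‖ ^ 2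
  K_nonneg : ∀ v w, 0 ≤ K v w
  K_sum : ∀ v, ∑ w, K v w = 1
  R_sum : ∀ v, ∑ w, |R v w| ≤ 3 * τ
  poisson : ∀ v w, ∑ u, K v u * R u w = R v w - ((if v = w then 1 else 0) - μ w)
  one_le_b : 1 ≤ b
  κ_pos : 0 < κ
  κ_le : κ ≤ 1
  two_le_p : 2 ≤ p
  one_le_τ : 1 ≤ τ
  α_pos : ∀ t, 0 < α t
  α_anti : Antitone α
  α_sub : ∀ t, α t - α (t + 1) ≤ α t ^ 2 * (κ / 32)
  α_small : p * (3 * τ) * b ^ 2 * α 0 ≤ κ / 30000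

/-- Solution of the Poisson equation for `v ↦ ⟨x, F x v⟩`. -/
noncomputable def corrector {E Z : Type*} [NormedAddCommGroup E] [InnerProductSpace ℝ E] [Fintype Z]
    (F : E → Z → E) (R : Z → Z → ℝ) (x : E) (v : Z) : ℝ := ∑ w, R v w * inner ℝ x (F x w)

/-- Corrected squared norm. -/
noncomputable def lyapunov {E Z : Type*} [NormedAddCommGroup E] [InnerProductSpace ℝ E] [Fintype Z]
    (F : E → Z → E) (R : Z → Z → ℝ) (L : ℝ) (α : ℕ → ℝ) (t : ℕ) (x : E) (v : Z) : ℝ :=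
  ‖x‖ ^ 2 + 2 * α t * corrector F R x v + L * α t

namespace SASetup

variable {E Z : Type*} [NormedAddCommGroup E] [InnerProductSpace ℝ E] [Fintype Z] [DecidableEq Z]
  {F : E → Z → E} {K : Matrix Z Z ℝ} {μ : Z → ℝ} {R : Z → Z → ℝ} {α : ℕ → ℝ} {b κ p : ℝ} {τ : ℕ}

theorem abs_sum_R_le (h : SASetup F K μ R α b κ p τ) {f : Z → ℝ} {B : ℝ} (hf : ∀ w, |f w| ≤ B)
    (v : Z) : |∑ w, R v w * f w| ≤ 3 * τ * B := by
  have hB : 0 ≤ B := (abs_nonneg _).trans (hf v)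
  calc |∑ w, R v w * f w| ≤ ∑ w, |R v w * f w| := Finset.abs_sum_le_sum_abs _ _
    _ ≤ ∑ w, |R v w| * B := Finset.sum_le_sum fun w _ => by
        rw [abs_mul]; exact mul_le_mul_of_nonneg_left (hf w) (abs_nonneg _)
    _ = (∑ w, |R v w|) * B := by rw [Finset.sum_mul]
    _ ≤ 3 * τ * B := mul_le_mul_of_nonneg_right (h.R_sum v) hB

theorem abs_sum_K_le (h : SASetup F K μ R α b κ p τ) {f : Z → ℝ} {B : ℝ} (hf : ∀ w, |f w| ≤ B)
    (v : Z) : |∑ w, K v w * f w| ≤ B := by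
  calc |∑ w, K v w * f w| ≤ ∑ w, |K v w * f w| := Finset.abs_sum_le_sum_abs _ _
    _ ≤ ∑ w, K v w * B := Finset.sum_le_sum fun w _ => by
        rw [abs_mul, abs_of_nonneg (h.K_nonneg v w)]
        exact mul_le_mul_of_nonneg_left (hf w) (h.K_nonneg v w)
    _ = B := by rw [← Finset.sum_mul, h.K_sum, one_mul]

theorem abs_corrector_le (h : SASetup F K μ R α b κ p τ) (x : E) (v : Z) :
    |corrector F R x v| ≤ 3 * τ * (b * (‖x‖ * (1 + ‖x‖))) := by
  refine h.abs_sum_R_le (fun w => ?_) v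
  calc |inner ℝ x (F x w)| ≤ ‖x‖ * ‖F x w‖ := abs_real_inner_le_norm _ _
    _ ≤ ‖x‖ * (b * (1 + ‖x‖)) := mul_le_mul_of_nonneg_left (h.growth x w) (norm_nonneg _)
    _ = _ := by ring

theorem abs_corrector_sub_le (h : SASetup F K μ R α b κ p τ) (x y : E) (v : Z) :
    |corrector F R y v - corrector F R x v|
      ≤ 3 * τ * (b * ‖y - x‖ * (1 + ‖y‖ + ‖x‖)) := by
  unfold corrector
  rw [← Finset.sum_sub_distrib]
  simp_rw [← mul_sub]
  refine h.abs_sum_R_le (fun w => ?_) v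
  have : inner ℝ y (F y w) - inner ℝ x (F x w)
      = inner ℝ (y - x) (F y w) + inner ℝ x (F y w - F x w) := by
    rw [inner_sub_left, inner_sub_right]; ring
  rw [this]
  have h1 := abs_real_inner_le_norm (y - x) (F y w)
  have h2 := abs_real_inner_le_norm x (F y w - F x w)
  have h3 := mul_le_mul_of_nonneg_left (h.growth y w) (norm_nonneg (y - x))
  have h4 := mul_le_mul_of_nonneg_left (h.lip y x w) (norm_nonneg x)
  refine (abs_add_le _ _).trans ?_
  linarith

theorem sum_K_corrector (h : SASetup F K μ R α b κ p τ) (x : E) (v : Z) :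
    ∑ u, K v u * corrector F R x u
      = corrector F R x v - inner ℝ x (F x v) + ∑ w, μ w * inner ℝ x (F x w) := by
  unfold corrector
  simp_rw [Finset.mul_sum]
  rw [Finset.sum_comm]
  simp_rw [← mul_assoc, ← Finset.sum_mul, h.poisson, sub_mul, Finset.sum_sub_distrib]
  simp
  ring

theorem small (h : SASetup F K μ R α b κ p τ) (t : ℕ) :
    p * (α t * τ * b ^ 2) ≤ κ / 90000 := by
  have h1 : p * (3 * τ) * b ^ 2 * α t ≤ p * (3 * τ) * b ^ 2 * α 0 :=
    mul_le_mul_of_nonneg_left (h.α_anti (Nat.zero_le t)) (by have := h.two_le_p; positivity)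
  linarith [h.α_small]

theorem one_le_τ_real (h : SASetup F K μ R α b κ p τ) : (1 : ℝ) ≤ τ := by
  exact_mod_cast h.one_le_τ

/-- Conditional drift of the Lyapunov function along one step. -/
theorem sum_K_lyapunov_le (h : SASetup F K μ R α b κ p τ) {L : ℝ} (hL : 0 ≤ L) (t : ℕ) (x : E)
    (v : Z) :
    ∑ u, K v u * lyapunov F R L α (t + 1) (x + α t • F x v) u
      ≤ lyapunov F R L α t x v - 3 / 4 * (α t * κ * ‖x‖ ^ 2) + 54 * (τ * α t ^ 2 * b ^ 2) := by
  set y := x + α t • F x v with hy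
  set n := ‖x‖ with hn
  have hn0 : 0 ≤ n := norm_nonneg x
  have hb := h.one_le_b
  have hκ := h.κ_pos
  have hκ1 := h.κ_le
  have hτ := h.one_le_τ_real
  have hp := h.two_le_p
  have ha := h.α_pos t
  have ha' := h.α_pos (t + 1)
  have haa : α (t + 1) ≤ α t := h.α_anti (Nat.le_succ t)
  have hs := h.small t
  have hs1 : α t * τ * b ^ 2 ≤ κ / 180000 := by
    have : 2 * (α t * τ * b ^ 2) ≤ p * (α t * τ * b ^ 2) :=
      mul_le_mul_of_nonneg_right hp (by positivity)
    linarith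
  have hab : α t * b ≤ 1 := by
    have : α t * b ≤ α t * τ * b ^ 2 := by
      calc α t * b ≤ (α t * b) * (τ * b) :=
            le_mul_of_one_le_right (by positivity) (one_le_mul_of_one_le_of_one_le hτ hb)
        _ = _ := by ring
    linarith
  have hF := h.growth x v
  have hyx : ‖y - x‖ ≤ α t * (b * (1 + n)) := by
    rw [hy, add_sub_cancel_left, norm_smul, Real.norm_of_nonneg ha.le]
    exact mul_le_mul_of_nonneg_left hF ha.le
  have hyn : ‖y‖ ≤ 2 * n + 1 := by
    have h1 : ‖y‖ ≤ ‖x‖ + ‖y - x‖ := by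
      simpa using norm_add_le x (y - x)
    have h2 : α t * (b * (1 + n)) ≤ 1 + n := by
      rw [← mul_assoc]; exact mul_le_of_le_one_left (by linarith) hab
    linarith
  have hsq : ‖y‖ ^ 2 ≤ n ^ 2 + 2 * α t * inner ℝ x (F x v) + α t ^ 2 * b ^ 2 * (1 + n) ^ 2 := by
    rw [hy, norm_add_sq_real, inner_smul_right, norm_smul, Real.norm_of_nonneg ha.le]
    have : (α t * ‖F x v‖) ^ 2 ≤ (α t * (b * (1 + n))) ^ 2 := by gcongr
    linarith
  have hexp : ∑ u, K v u * lyapunov F R L α (t + 1) y u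
      = ‖y‖ ^ 2 + 2 * α (t + 1) * ∑ u, K v u * corrector F R y u + L * α (t + 1) := by
    unfold lyapunov
    simp_rw [mul_add, Finset.sum_add_distrib, ← Finset.sum_mul, h.K_sum, one_mul, Finset.mul_sum]
    congr 2
    refine Finset.sum_congr rfl fun u _ => ?_
    ring
  have hdiff : |∑ u, K v u * corrector F R y u - ∑ u, K v u * corrector F R x u|
      ≤ 3 * τ * (3 * (α t * b ^ 2 * (1 + n) ^ 2)) := by
    rw [← Finset.sum_sub_distrib]
    simp_rw [← mul_sub]
    refine h.abs_sum_K_le (fun u => (h.abs_corrector_sub_le x y u).trans ?_) v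
    refine mul_le_mul_of_nonneg_left ?_ (by positivity)
    calc b * ‖y - x‖ * (1 + ‖y‖ + ‖x‖) ≤ b * (α t * (b * (1 + n))) * (3 * (1 + n)) := by
          gcongr
          linarith
      _ = _ := by ring
  have hbd : |∑ u, K v u * corrector F R x u| ≤ 3 * τ * (b * (n * (1 + n))) :=
    h.abs_sum_K_le (fun u => h.abs_corrector_le x u) v
  have hpo := h.sum_K_corrector x v
  have hdr := h.drift x
  rw [hexp]
  unfold lyapunov
  set G := ∑ u, K v u * corrector F R x u
  set G' := ∑ u, K v u * corrector F R y u
  set I := inner ℝ x (F x v)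
  set D := ∑ w, μ w * inner ℝ x (F x w)
  -- The `18` pays for moving the corrector's argument from `x` to `y`, the `6` for replacing `α (t
  -- + 1)` by `α t`.
  have e1 : 2 * α (t + 1) * G' ≤ 2 * α t * G + 18 * (τ * (α t ^ 2 * b ^ 2 * (1 + n) ^ 2))
      + 6 * (τ * (α t ^ 2 * b ^ 2 * (1 + n) ^ 2)) := by
    have g1 : α (t + 1) * (G' - G) ≤ α t * (3 * τ * (3 * (α t * b ^ 2 * (1 + n) ^ 2))) :=
      (mul_le_mul_of_nonneg_left ((le_abs_self _).trans hdiff) ha'.le).trans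
        (mul_le_mul_of_nonneg_right haa (by positivity))
    have g2 : -(α t - α (t + 1)) * G ≤ (α t ^ 2 * 1) * (3 * τ * (b * (n * (1 + n)))) := by
      have : -(α t - α (t + 1)) * G ≤ (α t - α (t + 1)) * |G| := by
        rw [neg_mul, ← mul_neg]
        exact mul_le_mul_of_nonneg_left (neg_le_abs G) (by linarith)
      refine this.trans (mul_le_mul ((h.α_sub t).trans ?_) hbd (abs_nonneg _) (by positivity))
      exact mul_le_mul_of_nonneg_left (by linarith) (by positivity)
    have g3 : b * (n * (1 + n)) ≤ b ^ 2 * (1 + n) ^ 2 := by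
      have : n * (1 + n) ≤ (1 + n) ^ 2 := by
        rw [sq]; exact mul_le_mul_of_nonneg_right (by linarith) (by linarith)
      have : b ≤ b ^ 2 := le_self_pow₀ hb two_ne_zero
      gcongr
    have g4 : (α t ^ 2 * 1) * (3 * τ * (b * (n * (1 + n))))
        ≤ (α t ^ 2 * 1) * (3 * τ * (b ^ 2 * (1 + n) ^ 2)) := by gcongr
    have g5 : 2 * α (t + 1) * G' = 2 * α t * G + 2 * (α (t + 1) * (G' - G))
        + 2 * (-(α t - α (t + 1)) * G) := by ring
    rw [g5]
    generalize α (t + 1) * (G' - G) = u1 at *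
    generalize -(α t - α (t + 1)) * G = u2 at *
    clear * - g1 g2 g4
    linarith
  have e2 : α t ^ 2 * b ^ 2 * (1 + n) ^ 2 ≤ τ * (α t ^ 2 * b ^ 2 * (1 + n) ^ 2) :=
    le_mul_of_one_le_left (by positivity) hτ
  have e3 : τ * (α t ^ 2 * b ^ 2 * (1 + n) ^ 2) ≤ 2 * (τ * α t ^ 2 * b ^ 2) * (1 + n ^ 2) := by
    have : (1 + n) ^ 2 ≤ 2 * (1 + n ^ 2) := by simpa using add_sq_le (a := 1) (b := n)
    calc _ ≤ τ * (α t ^ 2 * b ^ 2 * (2 * (1 + n ^ 2))) := by gcongr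
      _ = _ := by ring
  -- Here `50 = 2 * (18 + 6 + 1)`, the last unit being the squared increment of `x`; this part of
  -- the noise costs a quarter of the drift.
  have e4 : 50 * (τ * α t ^ 2 * b ^ 2) * n ^ 2 ≤ 1 / 4 * (α t * κ * n ^ 2) := by
    have : 50 * (α t * τ * b ^ 2) ≤ κ / 4 := by
      clear * - hs1 hκ
      linarith
    calc _ = 50 * (α t * τ * b ^ 2) * (α t * n ^ 2) := by ring
      _ ≤ κ / 4 * (α t * n ^ 2) := mul_le_mul_of_nonneg_right this (by positivity)
      _ = _ := by ring
  have e5 : α t * D ≤ -(α t * κ * n ^ 2) / 2 := by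
    calc α t * D ≤ α t * (-(κ / 2) * n ^ 2) := mul_le_mul_of_nonneg_left hdr ha.le
      _ = _ := by ring
  have e6 : L * α (t + 1) ≤ L * α t := mul_le_mul_of_nonneg_left haa hL
  have e7 : 0 ≤ τ * α t ^ 2 * b ^ 2 := by positivity
  -- The term `-2 * α t * I` cancels the first-order term of `hsq`, so only the stationary mean `D`
  -- is left.
  have e8 : 2 * α t * G = 2 * α t * corrector F R x v - 2 * α t * I + 2 * (α t * D) := by
    rw [hpo]; ring
  clear * - hsq e1 e2 e3 e4 e5 e6 e7 e8
  linarith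

end SASetup

/-! ### Scalar inequalities for the Lyapunov function and its powers -/

theorem rpow_one_add_le {p u : ℝ} (hp : 2 ≤ p) (hu : |p * u| ≤ 1) :
    (1 + u) ^ p ≤ 1 + p * u + (p * u) ^ 2 := by
  have hu' : -1 ≤ u := by
    have h := neg_le_of_abs_le hu
    by_contra hlt
    push Not at hlt
    have : p * u < p * (-1) := mul_lt_mul_of_pos_left hlt (by linarith)
    linarith
  have h1 : (1 + u) ^ p ≤ Real.exp (p * u) := by
    rw [mul_comm, Real.exp_mul]
    exact Real.rpow_le_rpow (by linarith) (by linarith [Real.add_one_le_exp u]) (by linarith)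
  have h2 := (abs_le.1 (Real.abs_exp_sub_one_sub_id_le hu)).2
  linarith

/-- Second order expansion of `Y ↦ Y ^ p` under a small relative increment. -/
theorem rpow_increment_le {p Y Y' δ β a : ℝ} (hp : 2 ≤ p) (hY : 0 < Y) (hδ : 0 < δ)
    (haY : a ≤ 2 * Y) (h1 : p * δ ≤ 1 / 90000) (h2 : (p * δ) ^ 2 ≤ a / 10 ^ 9)
    (h4 : p * δ ^ 2 ≤ β / 90000) (h5 : p * δ ^ 2 * 12000 = β * a)
    (hΔ : |Y' - Y| ≤ 69 * δ * (√Y + Y)) :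
    |Y' - Y| ≤ Y / p ∧
    Y' ^ p ≤ Y ^ p + p * (Y ^ (p - 1) * (Y' - Y)) + p * β * (Y ^ p / 8 + a * Y ^ (p - 1)) := by
  set s := √Y with hs
  have hs0 : 0 < s := Real.sqrt_pos.2 hY
  have hss : s ^ 2 = Y := Real.sq_sqrt hY.le
  have hp0 : 0 < p := by linarith
  have hpδs : p * δ ≤ s / 10000 := by
    refine le_of_sq_le_sq ?_ (by positivity)
    rw [div_pow, hss]
    linarith
  have hsmall : p * |Y' - Y| ≤ Y := by
    have e1 : p * |Y' - Y| ≤ 69 * (p * δ) * s + 69 * (p * δ) * Y :=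
      (mul_le_mul_of_nonneg_left hΔ hp0.le).trans_eq (by ring)
    have e2 : (p * δ) * s ≤ s / 10000 * s := mul_le_mul_of_nonneg_right hpδs hs0.le
    have e3 : (p * δ) * Y ≤ 1 / 90000 * Y := mul_le_mul_of_nonneg_right h1 hY.le
    have e4 : s / 10000 * s = Y / 10000 := by rw [← hss]; ring
    linarith
  refine ⟨by rw [le_div_iff₀ hp0]; linarith, ?_⟩
  set u := (Y' - Y) / Y with hu
  have hYu : Y * u = Y' - Y := by rw [hu]; field_simp
  have hpu : |p * u| ≤ 1 := by
    rw [hu, abs_mul, abs_div, abs_of_pos hp0, abs_of_pos hY, ← mul_div_assoc, div_le_one hY]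
    exact hsmall
  have hY' : Y' = Y * (1 + u) := by rw [mul_add, hYu]; ring
  have hu1 : 0 ≤ 1 + u := by
    have hpu' := neg_le_of_abs_le hpu
    by_contra hlt
    push Not at hlt
    have : p * u < p * (-1) := mul_lt_mul_of_pos_left (by linarith) (by linarith)
    linarith
  have hP : Y ^ p = Y ^ (p - 1) * Y := by
    rw [Real.rpow_sub_one hY.ne']; field_simp
  have hP0 : 0 < Y ^ (p - 1) := Real.rpow_pos_of_pos hY _
  -- Squaring `hΔ` produces `9522 = 2 * 69 ^ 2`. The constant part fits under `12000` in `h5`, and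
  -- the part proportional to `Y` fits since `9522 / 90000 ≤ 1 / 8`.
  have hv : Y * (p * u) ^ 2 ≤ p * β * (Y / 8 + a) := by
    have e1 : (Y' - Y) ^ 2 ≤ (69 * δ * (s + Y)) ^ 2 := by
      rw [← sq_abs (Y' - Y)]; gcongr
    have e2 : (s + Y) ^ 2 ≤ 2 * Y * (1 + Y) := by
      calc (s + Y) ^ 2 ≤ 2 * (s ^ 2 + Y ^ 2) := add_sq_le
        _ = _ := by rw [hss]; ring
    have e3 : Y * (Y * (p * u) ^ 2) ≤ Y * (p * β * (Y / 8 + a)) := by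
      calc Y * (Y * (p * u) ^ 2) = p ^ 2 * (Y * u) ^ 2 := by ring
        _ ≤ p ^ 2 * (69 * δ * (s + Y)) ^ 2 := by rw [hYu]; gcongr
        _ = p ^ 2 * (4761 * δ ^ 2) * (s + Y) ^ 2 := by ring
        _ ≤ p ^ 2 * (4761 * δ ^ 2) * (2 * Y * (1 + Y)) := by gcongr
        _ = Y * (p * (9522 * (p * δ ^ 2) + 9522 * (p * δ ^ 2) * Y)) := by ring
        _ ≤ Y * (p * (β * a + β / 8 * Y)) := by
            have : 0 ≤ p * δ ^ 2 := by positivity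
            have : 9522 * (p * δ ^ 2) * Y ≤ β / 8 * Y :=
              mul_le_mul_of_nonneg_right (by linarith) hY.le
            refine mul_le_mul_of_nonneg_left (mul_le_mul_of_nonneg_left ?_ hp0.le) hY.le
            linarith
        _ = _ := by ring
    exact le_of_mul_le_mul_left e3 hY
  calc Y' ^ p = Y ^ p * (1 + u) ^ p := by rw [hY', Real.mul_rpow hY.le hu1]
    _ ≤ Y ^ p * (1 + p * u + (p * u) ^ 2) :=
        mul_le_mul_of_nonneg_left (rpow_one_add_le hp hpu) (Real.rpow_nonneg hY.le _)
    _ = Y ^ p + p * (Y ^ (p - 1) * (Y * u)) + Y ^ (p - 1) * (Y * (p * u) ^ 2) := by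
        rw [hP]; ring
    _ ≤ Y ^ p + p * (Y ^ (p - 1) * (Y' - Y)) + Y ^ (p - 1) * (p * β * (Y / 8 + a)) := by
        rw [hYu]; gcongr
    _ = _ := by rw [hP]; ring

theorem lyapunov_compare {n c δ a : ℝ} (h1 : δ ≤ 1 / 180000) (h2 : δ ^ 2 ≤ a / 10 ^ 9) (hc : |c| ≤ 6 * δ * (n * (1 + n))) :
    n ^ 2 / 2 + a / 2 ≤ n ^ 2 + c + a ∧ n ^ 2 + c + a ≤ 3 / 2 * (n ^ 2 + a) := by
  have e1 : 6 * δ * n ≤ n ^ 2 / 4 + 36 * δ ^ 2 := by linarith [sq_nonneg (n / 2 - 6 * δ)]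
  have e2 : δ * n ^ 2 ≤ 1 / 180000 * n ^ 2 := mul_le_mul_of_nonneg_right h1 (sq_nonneg n)
  have e3 : 6 * δ * (n * (1 + n)) = 6 * δ * n + 6 * (δ * n ^ 2) := by ring
  have h := abs_le.1 hc
  have := sq_nonneg n
  have := sq_nonneg δ
  constructor <;> linarith

/-- No cancellation between the two correctors is needed: each is of order `δ`, like the
displacement `n' - n` over a block. The shift `a` dominates `δ²`, which lets everything be measured
by `√Y` and `Y`. -/
theorem lyapunov_increment {n n' c c' δ β a a' Y Y' : ℝ} (hn : 0 ≤ n) (hn' : 0 ≤ n') (hδ : 0 < δ)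
    (h1 : δ ≤ 1 / 180000) (h2 : δ ^ 2 ≤ a / 10 ^ 9) (hβ : β ≤ δ) (ha' : a' ≤ a)
    (haa : a - a' ≤ a * β / 32) (hnn : |n' - n| ≤ 2 * δ * (1 + n))
    (hc : |c| ≤ 6 * δ * (n * (1 + n))) (hc' : |c'| ≤ 6 * δ * (n' * (1 + n')))
    (hY : Y = n ^ 2 + c + a) (hY' : Y' = n' ^ 2 + c' + a') :
    |Y' - Y| ≤ 69 * δ * (√Y + Y) := by
  have hcomp := (lyapunov_compare h1 h2 hc).1
  rw [← hY] at hcomp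
  have ha : 0 ≤ a := by have := sq_nonneg δ; linarith
  have hn2 := sq_nonneg n
  have hY0 : 0 ≤ Y := by linarith
  set s := √Y with hs
  have hs0 : 0 ≤ s := Real.sqrt_nonneg Y
  have hss : s ^ 2 = Y := Real.sq_sqrt hY0
  have hns : n ≤ 3 / 2 * s := by
    refine le_of_sq_le_sq ?_ (by positivity)
    rw [mul_pow, hss]
    linarith
  have hδs : δ ≤ s / 100 := by
    refine le_of_sq_le_sq ?_ (by positivity)
    rw [div_pow, hss]
    linarith
  have hup : n' ≤ n + 2 * δ * (1 + n) := by linarith [(abs_le.1 hnn).2]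
  have hδn : 2 * δ * (1 + n) ≤ 1 * (1 + n) := mul_le_mul_of_nonneg_right (by linarith) (by linarith)
  have hup2 : 1 + n' ≤ 2 * (1 + n) := by linarith
  have e1 : |n' ^ 2 - n ^ 2| ≤ 2 * δ * (1 + n) * (2 * n + 2 * δ * (1 + n)) := by
    rw [show n' ^ 2 - n ^ 2 = (n' - n) * (n' + n) by ring, abs_mul, abs_of_nonneg (by linarith : 0 ≤ n' + n)]
    exact mul_le_mul hnn (by linarith) (by linarith) (by positivity)
  have e2 : 6 * δ * (n' * (1 + n')) ≤ 6 * δ * ((n + 2 * δ * (1 + n)) * (2 * (1 + n))) := by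
    gcongr
  have e3 : |Y' - Y| ≤ |n' ^ 2 - n ^ 2| + |c'| + |c| + |a' - a| := by
    rw [hY, hY', show n' ^ 2 + c' + a' - (n ^ 2 + c + a)
      = (n' ^ 2 - n ^ 2) + c' + (-c) + (a' - a) by ring]
    refine (abs_add_le _ _).trans (add_le_add ((abs_add_le _ _).trans (add_le_add
      (abs_add_le _ _) (abs_neg c).le)) le_rfl)
  have e4 : |a' - a| ≤ a * δ / 32 := by
    rw [abs_sub_comm, abs_of_nonneg (by linarith)]
    have := mul_le_mul_of_nonneg_left hβ ha
    linarith
  have e5 : δ * n ≤ δ * (3 / 2 * s) := mul_le_mul_of_nonneg_left hns hδ.le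
  have e6 : δ * n ^ 2 ≤ δ * (2 * Y) := mul_le_mul_of_nonneg_left (by linarith) hδ.le
  have e7 : δ ^ 2 ≤ δ * (s / 100) := by rw [sq]; exact mul_le_mul_of_nonneg_left hδs hδ.le
  have e8 : a * δ ≤ 2 * Y * δ := mul_le_mul_of_nonneg_right (by linarith) hδ.le
  have e9 : δ ^ 2 * n ^ 2 ≤ 1 / 180000 * (δ * n ^ 2) := by
    rw [sq δ, mul_assoc]; exact mul_le_mul_of_nonneg_right h1 (by positivity)
  have e10 : δ ^ 2 * n ≤ 1 / 180000 * (δ * n) := by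
    rw [sq δ, mul_assoc]; exact mul_le_mul_of_nonneg_right h1 (by positivity)
  have e11 : 0 ≤ δ * s := by positivity
  have e12 : 0 ≤ δ * Y := by positivity
  have e13 : 2 * δ * (1 + n) * (2 * n + 2 * δ * (1 + n)) + 6 * δ * (n * (1 + n))
      + 6 * δ * ((n + 2 * δ * (1 + n)) * (2 * (1 + n)))
      = 22 * (δ * n) + 22 * (δ * n ^ 2) + 28 * δ ^ 2 + 56 * (δ ^ 2 * n) + 28 * (δ ^ 2 * n ^ 2) := by
    ring
  clear * - e1 e2 e3 e4 e5 e6 e7 e8 e9 e10 e11 e12 e13 hc hc'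
  linarith

/-! ### Pathwise estimates over a block of length at most `τ` -/

/-- Shift of the Lyapunov function, up to the step size. -/
noncomputable def level (b κ p : ℝ) (τ : ℕ) : ℝ := 12000 * p * τ * b ^ 2 / κ

namespace SASetup

variable {E Z : Type*} [NormedAddCommGroup E] [InnerProductSpace ℝ E] [Fintype Z] [DecidableEq Z]
  {F : E → Z → E} {K : Matrix Z Z ℝ} {μ : Z → ℝ} {R : Z → Z → ℝ} {α : ℕ → ℝ} {b κ p : ℝ} {τ : ℕ}

theorem level_pos (h : SASetup F K μ R α b κ p τ) : 0 < level b κ p τ := by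
  have := h.two_le_p
  have := h.κ_pos
  have := h.one_le_b
  have := h.one_le_τ_real
  unfold level
  positivity

theorem δ_pos (h : SASetup F K μ R α b κ p τ) (t : ℕ) : 0 < α t * τ * b := by
  have := h.α_pos t
  have := h.one_le_b
  have := h.one_le_τ_real
  positivity

theorem β_pos (h : SASetup F K μ R α b κ p τ) (t : ℕ) : 0 < α t * τ * κ := by
  have := h.α_pos t
  have := h.κ_pos
  have := h.one_le_τ_real
  positivity

theorem p_δ_le (h : SASetup F K μ R α b κ p τ) (t : ℕ) : p * (α t * τ * b) ≤ 1 / 90000 := by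
  have h1 := h.small t
  have h2 := h.κ_le
  have h3 := (h.δ_pos t).le
  have h4 : p * (α t * τ * b) ≤ p * (α t * τ * b ^ 2) := by
    rw [sq, ← mul_assoc (α t * τ)]
    exact mul_le_mul_of_nonneg_left (le_mul_of_one_le_right h3 h.one_le_b)
      (by linarith [h.two_le_p])
  linarith

theorem δ_le (h : SASetup F K μ R α b κ p τ) (t : ℕ) : α t * τ * b ≤ 1 / 180000 := by
  have h1 := h.p_δ_le t
  have h2 := mul_le_mul_of_nonneg_right h.two_le_p (h.δ_pos t).le
  linarith

theorem β_le (h : SASetup F K μ R α b κ p τ) (t : ℕ) : α t * τ * κ ≤ α t * τ * b := by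
  have := h.α_pos t
  exact mul_le_mul_of_nonneg_left (h.κ_le.trans h.one_le_b) (by positivity)

theorem p_δ_sq_le (h : SASetup F K μ R α b κ p τ) (t : ℕ) :
    p * (α t * τ * b) ^ 2 ≤ α t * τ * κ / 90000 := by
  have := h.α_pos t
  calc p * (α t * τ * b) ^ 2 = (p * (α t * τ * b ^ 2)) * (α t * τ) := by ring
    _ ≤ κ / 90000 * (α t * τ) := mul_le_mul_of_nonneg_right (h.small t) (by positivity)
    _ = _ := by ring

/-- This identity dictates the choice of `level`: the second-order cost `p δ²` of a block is a fixed
fraction of the contraction rate `β` times the shift. -/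
theorem p_δ_sq_eq (h : SASetup F K μ R α b κ p τ) (t : ℕ) :
    p * (α t * τ * b) ^ 2 * 12000 = α t * τ * κ * (level b κ p τ * α t) := by
  have := h.κ_pos.ne'
  unfold level
  field_simp

theorem sq_p_δ_le (h : SASetup F K μ R α b κ p τ) (t : ℕ) :
    (p * (α t * τ * b)) ^ 2 ≤ level b κ p τ * α t / 10 ^ 9 := by
  have h1 := h.p_δ_sq_eq t
  have h2 := h.p_δ_le t
  have hp := h.two_le_p
  have ha := mul_pos h.level_pos (h.α_pos t)
  have h3 : p * (α t * τ * κ) ≤ 1 / 90000 :=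
    (mul_le_mul_of_nonneg_left (h.β_le t) (by linarith)).trans h2
  have h4 := mul_le_mul_of_nonneg_right h3 ha.le
  have h5 : (p * (α t * τ * b)) ^ 2 = p * (α t * τ * κ) * (level b κ p τ * α t) / 12000 := by
    rw [mul_assoc p, ← h1]; ring
  linarith

theorem δ_sq_le (h : SASetup F K μ R α b κ p τ) (t : ℕ) :
    (α t * τ * b) ^ 2 ≤ level b κ p τ * α t / 10 ^ 9 := by
  refine le_trans ?_ (h.sq_p_δ_le t)
  have := (h.δ_pos t).le
  refine pow_le_pow_left₀ this ?_ 2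
  exact le_mul_of_one_le_left this (by linarith [h.two_le_p])

theorem abs_two_mul_corrector_le (h : SASetup F K μ R α b κ p τ) {s t : ℕ} (hst : t ≤ s) (x : E)
    (v : Z) : |2 * α s * corrector F R x v| ≤ 6 * (α t * τ * b) * (‖x‖ * (1 + ‖x‖)) := by
  have h1 := h.abs_corrector_le x v
  have h2 := h.α_pos s
  have h3 := h.one_le_b
  rw [abs_mul, abs_of_pos (by positivity)]
  calc 2 * α s * |corrector F R x v| ≤ 2 * α t * (3 * τ * (b * (‖x‖ * (1 + ‖x‖)))) := by
        refine mul_le_mul (by linarith [h.α_anti hst]) h1 (abs_nonneg _) ?_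
        linarith [h.α_pos t]
    _ = _ := by ring

theorem lyapunov_bounds (h : SASetup F K μ R α b κ p τ) (t : ℕ) (x : E) (v : Z) :
    ‖x‖ ^ 2 / 2 + level b κ p τ * α t / 2 ≤ lyapunov F R (level b κ p τ) α t x v ∧
      lyapunov F R (level b κ p τ) α t x v ≤ 3 / 2 * (‖x‖ ^ 2 + level b κ p τ * α t) :=
  lyapunov_compare (h.δ_le t) (h.δ_sq_le t)
    (h.abs_two_mul_corrector_le le_rfl x v)

theorem lyapunov_pos (h : SASetup F K μ R α b κ p τ) (t : ℕ) (x : E) (v : Z) :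
    0 < lyapunov F R (level b κ p τ) α t x v := by
  have h1 := (h.lyapunov_bounds t x v).1
  have h2 := mul_pos h.level_pos (h.α_pos t)
  have h3 := sq_nonneg ‖x‖
  linarith

theorem α_sub_le (h : SASetup F K μ R α b κ p τ) (t k : ℕ) :
    α t - α (t + k) ≤ k * (α t ^ 2 * (κ / 32)) := by
  induction k with
  | zero => simp
  | succ k ih =>
    have h1 := h.α_sub (t + k)
    have h2 : α (t + k) ^ 2 ≤ α t ^ 2 :=
      pow_le_pow_left₀ (h.α_pos _).le (h.α_anti (Nat.le_add_right t k)) 2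
    have h3 := mul_le_mul_of_nonneg_right h2 (by linarith [h.κ_pos] : 0 ≤ κ / 32)
    rw [← add_assoc]
    push_cast
    linarith

theorem α_sub_le_of_le (h : SASetup F K μ R α b κ p τ) (t : ℕ) {k : ℕ} (hk : k ≤ τ) :
    α t - α (t + k) ≤ α t * (α t * τ * κ) / 32 := by
  have h1 := h.α_sub_le t k
  have h2 : (k : ℝ) ≤ τ := by exact_mod_cast hk
  have h3 := mul_le_mul_of_nonneg_right h2 (by have := h.κ_pos; positivity : 0 ≤ α t ^ 2 * (κ / 32))
  linarith

variable {x : ℕ → E} {z : ℕ → Z}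

/-- While `k ≤ τ` the bound stays below `1 + ‖x t‖`, so `1 + ‖x (t + k)‖ ≤ 2 * (1 + ‖x t‖)` and the
growth condition yields the next step with the factor `2`. -/
theorem norm_sub_le_block (h : SASetup F K μ R α b κ p τ)
    (hx : ∀ n, x (n + 1) = x n + α n • F (x n) (z n)) (t : ℕ) {k : ℕ} (hk : k ≤ τ) :
    ‖x (t + k) - x t‖ ≤ 2 * (α t * k * b) * (1 + ‖x t‖) := by
  induction k with
  | zero => simp
  | succ k ih =>
    have ih := ih (by omega)
    have hn := norm_nonneg (x t)
    have hb := h.one_le_b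
    have ha := h.α_pos t
    have h1 : (k : ℝ) ≤ τ := by exact_mod_cast (by omega : k ≤ τ)
    have h2 : α t * k * b ≤ α t * τ * b := by gcongr
    have h3 := h.δ_le t
    have h4 : ‖x (t + k)‖ ≤ ‖x t‖ + ‖x (t + k) - x t‖ := by
      simpa using norm_add_le (x t) (x (t + k) - x t)
    have h5 : 2 * (α t * k * b) * (1 + ‖x t‖) ≤ 1 * (1 + ‖x t‖) :=
      mul_le_mul_of_nonneg_right (by linarith) (by linarith)
    have h6 : ‖α (t + k) • F (x (t + k)) (z (t + k))‖ ≤ α t * (b * (2 * (1 + ‖x t‖))) := by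
      rw [norm_smul, Real.norm_of_nonneg (h.α_pos _).le]
      refine mul_le_mul (h.α_anti (Nat.le_add_right t k)) ((h.growth _ _).trans ?_)
        (norm_nonneg _) ha.le
      exact mul_le_mul_of_nonneg_left (by linarith) (by linarith)
    rw [← add_assoc, hx, add_sub_right_comm]
    refine (norm_add_le _ _).trans ?_
    push_cast
    linarith

theorem norm_sub_le (h : SASetup F K μ R α b κ p τ)
    (hx : ∀ n, x (n + 1) = x n + α n • F (x n) (z n)) (t : ℕ) {k : ℕ} (hk : k ≤ τ) :
    ‖x (t + k) - x t‖ ≤ 2 * (α t * τ * b) * (1 + ‖x t‖) := by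
  refine (h.norm_sub_le_block hx t hk).trans ?_
  have h1 : (k : ℝ) ≤ τ := by exact_mod_cast hk
  have := (h.α_pos t).le
  have := h.one_le_b
  gcongr

theorem abs_lyapunov_sub_le (h : SASetup F K μ R α b κ p τ)
    (hx : ∀ n, x (n + 1) = x n + α n • F (x n) (z n)) (t : ℕ) {k : ℕ} (hk : k ≤ τ) (v w : Z) :
    |lyapunov F R (level b κ p τ) α (t + k) (x (t + k)) w
        - lyapunov F R (level b κ p τ) α t (x t) v|
      ≤ 69 * (α t * τ * b) * (√(lyapunov F R (level b κ p τ) α t (x t) v)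
        + lyapunov F R (level b κ p τ) α t (x t) v) := by
  have hL := h.level_pos.le
  refine lyapunov_increment (a' := level b κ p τ * α (t + k)) (norm_nonneg (x t))
    (norm_nonneg (x (t + k))) (h.δ_pos t) (h.δ_le t)
    (h.δ_sq_le t) (h.β_le t) (mul_le_mul_of_nonneg_left (h.α_anti (Nat.le_add_right t k)) hL) ?_
    ((abs_norm_sub_norm_le _ _).trans (h.norm_sub_le hx t hk))
    (h.abs_two_mul_corrector_le le_rfl _ v) (h.abs_two_mul_corrector_le (Nat.le_add_right t k) _ w)
    rfl rfl
  have := mul_le_mul_of_nonneg_left (h.α_sub_le_of_le t hk) hL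
  linarith

theorem lyapunov_block (h : SASetup F K μ R α b κ p τ)
    (hx : ∀ n, x (n + 1) = x n + α n • F (x n) (z n)) (t : ℕ) {k : ℕ} (hk : k ≤ τ) (v w : Z) :
    |lyapunov F R (level b κ p τ) α (t + k) (x (t + k)) w
        - lyapunov F R (level b κ p τ) α t (x t) v|
        ≤ lyapunov F R (level b κ p τ) α t (x t) v / p ∧
    lyapunov F R (level b κ p τ) α (t + k) (x (t + k)) w ^ p
      ≤ lyapunov F R (level b κ p τ) α t (x t) v ^ p
        + p * (lyapunov F R (level b κ p τ) α t (x t) v ^ (p - 1)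
          * (lyapunov F R (level b κ p τ) α (t + k) (x (t + k)) w
            - lyapunov F R (level b κ p τ) α t (x t) v))
        + p * (α t * τ * κ) * (lyapunov F R (level b κ p τ) α t (x t) v ^ p / 8
          + level b κ p τ * α t * lyapunov F R (level b κ p τ) α t (x t) v ^ (p - 1)) := by
  refine rpow_increment_le h.two_le_p (h.lyapunov_pos t _ v) (h.δ_pos t) ?_ (h.p_δ_le t)
    (h.sq_p_δ_le t) (h.p_δ_sq_le t) (h.p_δ_sq_eq t) (h.abs_lyapunov_sub_le hx t hk v w)
  have h1 := (h.lyapunov_bounds t (x t) v).1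
  have := sq_nonneg ‖x t‖
  linarith

/-- Drift at a time inside a block, in terms of the state at the start of the block. -/
theorem drift_in_block (h : SASetup F K μ R α b κ p τ)
    (hx : ∀ n, x (n + 1) = x n + α n • F (x n) (z n)) (t : ℕ) {k : ℕ} (hk : k ≤ τ) :
    ∑ u, K (z (t + k)) u * lyapunov F R (level b κ p τ) α (t + k + 1) (x (t + k + 1)) u
      ≤ lyapunov F R (level b κ p τ) α (t + k) (x (t + k)) (z (t + k))
        - 3 / 8 * (α t * κ * ‖x t‖ ^ 2) + 57 * (τ * α t ^ 2 * b ^ 2) := by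
  have h0 := h.sum_K_lyapunov_le h.level_pos.le (t + k) (x (t + k)) (z (t + k))
  rw [← hx] at h0
  refine h0.trans ?_
  have ha := h.α_pos t
  have hb := h.one_le_b
  have hκ := h.κ_pos
  have hτ := h.one_le_τ_real
  have hδ := h.δ_le t
  have hδ0 := h.δ_pos t
  have haa := h.α_anti (Nat.le_add_right t k)
  have hα : 3 / 4 * α t ≤ α (t + k) := by
    have h1 := h.α_sub_le_of_le t hk
    have h2 := h.β_le t
    have h3 : α t * (α t * τ * κ) ≤ α t * 1 := mul_le_mul_of_nonneg_left (by linarith) ha.le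
    linarith
  have hd := h.norm_sub_le hx t hk
  have hsq : 3 / 4 * ‖x t‖ ^ 2 - 32 * (α t * τ * b) ^ 2 ≤ ‖x (t + k)‖ ^ 2 := by
    set d := α t * τ * b
    have h1 : ‖x t‖ ≤ ‖x (t + k)‖ + 2 * d * (1 + ‖x t‖) := by
      have := norm_add_le (x (t + k)) (x t - x (t + k))
      rw [add_sub_cancel, norm_sub_rev] at this
      linarith
    have hn0 := norm_nonneg (x t)
    generalize ‖x t‖ = n at *
    generalize ‖x (t + k)‖ = m at *
    clear * - h1 hδ hδ0 hn0
    have h2 : n ^ 2 ≤ (m + 2 * d * (1 + n)) ^ 2 := pow_le_pow_left₀ hn0 h1 2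
    have h3 : (m + 2 * d * (1 + n)) ^ 2 ≤ 5 / 4 * m ^ 2 + 5 * (2 * d * (1 + n)) ^ 2 := by
      linarith [sq_nonneg (m / 2 - 2 * (2 * d * (1 + n)))]
    have h4 : (2 * d * (1 + n)) ^ 2 ≤ 4 * d ^ 2 * (2 * (1 ^ 2 + n ^ 2)) := by
      rw [mul_pow, mul_pow]
      have : (1 + n) ^ 2 ≤ 2 * (1 ^ 2 + n ^ 2) := add_sq_le
      exact mul_le_mul (by norm_num) this (by positivity) (by positivity)
    have h5 : d ^ 2 * n ^ 2 ≤ 1 / 1000 * n ^ 2 :=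
      mul_le_mul_of_nonneg_right (by nlinarith) (sq_nonneg n)
    have h6 := sq_nonneg n
    linarith
  -- One factor `3/4` comes from the step size and one from the norm. Then `3/4 * 9/16 ≥ 3/8` is the
  -- remaining drift.
  have e1 : α (t + k) * κ * ‖x (t + k)‖ ^ 2
      ≥ 9 / 16 * (α t * κ * ‖x t‖ ^ 2) - 32 * (α t * κ * (α t * τ * b) ^ 2) := by
    have g1 : α (t + k) * κ * (3 / 4 * ‖x t‖ ^ 2 - 32 * (α t * τ * b) ^ 2)
        ≤ α (t + k) * κ * ‖x (t + k)‖ ^ 2 :=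
      mul_le_mul_of_nonneg_left hsq (mul_nonneg (h.α_pos _).le hκ.le)
    have g2 : 3 / 4 * α t * (κ * ‖x t‖ ^ 2) ≤ α (t + k) * (κ * ‖x t‖ ^ 2) :=
      mul_le_mul_of_nonneg_right hα (by positivity)
    have g3 : α (t + k) * (κ * (α t * τ * b) ^ 2) ≤ α t * (κ * (α t * τ * b) ^ 2) :=
      mul_le_mul_of_nonneg_right haa (by positivity)
    clear * - g1 g2 g3
    linarith
  have e2 : α t * κ * (α t * τ * b) ^ 2 ≤ 1 / 180000 * (τ * α t ^ 2 * b ^ 2) := by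
    calc α t * κ * (α t * τ * b) ^ 2 = (α t * τ * κ) * (τ * α t ^ 2 * b ^ 2) := by ring
      _ ≤ _ := mul_le_mul_of_nonneg_right ((h.β_le t).trans hδ) (by positivity)
  have e3 : τ * α (t + k) ^ 2 * b ^ 2 ≤ τ * α t ^ 2 * b ^ 2 := by
    have := (h.α_pos (t + k)).le
    gcongr
  have e4 : 0 ≤ α t * κ * ‖x t‖ ^ 2 := by positivity
  have e5 : 0 ≤ τ * α t ^ 2 * b ^ 2 := by positivity
  clear * - e1 e2 e3 e4 e5
  linarith

end SASetup

/-! ### Moment recursion over blocks -/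

theorem rpow_sub_one_mul_le {p y m : ℝ} (hp : 1 < p) (hy : 0 ≤ y) (hm : 0 ≤ m) :
    y ^ (p - 1) * m ≤ ((p - 1) * y ^ p + m ^ p) / p := by
  have hp0 : 0 < p := by linarith
  have h := Real.geom_mean_le_arith_mean2_weighted (w₁ := (p - 1) / p) (w₂ := 1 / p)
    (p₁ := y ^ p) (p₂ := m ^ p) (div_nonneg (by linarith) hp0.le) (by positivity)
    (by positivity) (by positivity) (by field_simp; ring)
  rw [← Real.rpow_mul hy, ← Real.rpow_mul hm, mul_div_cancel₀ _ hp0.ne',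
    mul_one_div_cancel hp0.ne', Real.rpow_one] at h
  refine h.trans_eq ?_
  field_simp

namespace SASetup

variable {E Z : Type*} [NormedAddCommGroup E] [InnerProductSpace ℝ E] [Fintype Z] [DecidableEq Z]
  {F : E → Z → E} {K : Matrix Z Z ℝ} {μ : Z → ℝ} {R : Z → Z → ℝ} {α : ℕ → ℝ} {b κ p : ℝ} {τ : ℕ}
  {Ω : Type*} {z : ℕ → Ω → Z} {X : ℕ → Ω → E} {x₀ : E}

omit [Fintype Z] [DecidableEq Z] in
theorem past_iterate (hX0 : ∀ ω, X 0 ω = x₀)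
    (hX : ∀ n ω, X (n + 1) ω = X n ω + α n • F (X n ω) (z n ω)) {n m : ℕ} (h : n ≤ m + 1) :
    Past z m (X n) := by
  induction n with
  | zero => intro x y _; rw [hX0, hX0]
  | succ n ih =>
    have e : X (n + 1) = fun ω => X n ω + α n • F (X n ω) (z n ω) := funext (hX n)
    rw [e]
    exact (ih (by omega)).comp₂ (Past.obs z (by omega)) (fun x v => x + α n • F x v)

omit [DecidableEq Z] in
theorem past_lyapunov (hX0 : ∀ ω, X 0 ω = x₀)
    (hX : ∀ n ω, X (n + 1) ω = X n ω + α n • F (X n ω) (z n ω)) (L : ℝ) {n m : ℕ} (h : n ≤ m) :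
    Past z m (fun ω => lyapunov F R L α n (X n ω) (z n ω)) :=
  (past_iterate hX0 hX (by omega)).comp₂ (Past.obs z h) (lyapunov F R L α n)

variable [MeasurableSpace Ω] {ℙ : Measure Ω} [IsProbabilityMeasure ℙ] {ν : Z → ℝ}

/-- The weight `G`, later `Y ^ (p - 1)`, is frozen at the start of the block, so the Markov property
applies at each step inside it; `drift_in_block` makes every step contribute the same quantity, also
frozen at time `t`. -/
theorem integral_mul_lyapunov_sub_le (h : SASetup F K μ R α b κ p τ) (hz : IsMarkovChain ℙ ν K z)
    (hX0 : ∀ ω, X 0 ω = x₀) (hX : ∀ n ω, X (n + 1) ω = X n ω + α n • F (X n ω) (z n ω))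
    (t : ℕ) {G : Ω → ℝ} (hG : Past z t G) (hG0 : ∀ ω, 0 ≤ G ω) {k : ℕ} (hk : k ≤ τ) :
    ∫ ω, G ω * (lyapunov F R (level b κ p τ) α (t + k) (X (t + k) ω) (z (t + k) ω)
        - lyapunov F R (level b κ p τ) α t (X t ω) (z t ω)) ∂ℙ
      ≤ k * ∫ ω, G ω * (-(3 / 8 * (α t * κ * ‖X t ω‖ ^ 2)) + 57 * (τ * α t ^ 2 * b ^ 2)) ∂ℙ := by
  have hY : ∀ {n m : ℕ}, n ≤ m →
      Past z m (fun ω => lyapunov F R (level b κ p τ) α n (X n ω) (z n ω)) := fun hnm =>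
    past_lyapunov hX0 hX _ hnm
  have hXp : ∀ {n m : ℕ}, n ≤ m + 1 → Past z m (X n) := fun hnm => past_iterate hX0 hX hnm
  induction k with
  | zero => simp
  | succ k ih =>
    have ih := ih (by omega)
    have hGk : Past z (t + k) G := hG.mono (by omega)
    have hH : Past z (t + k) (fun ω v => G ω *
        (lyapunov F R (level b κ p τ) α (t + k + 1) (X (t + k + 1) ω) v
        - lyapunov F R (level b κ p τ) α t (X t ω) (z t ω))) :=
      (hGk.comp₂ (hXp le_rfl) (fun g x => (g, x))).comp₂ (hY (Nat.le_add_right t k))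
        (fun q y v => q.1 * (lyapunov F R (level b κ p τ) α (t + k + 1) q.2 v - y))
    have e1 := hz.integral_succ hH
    rw [← add_assoc, e1]
    have hI : Integrable (fun ω => G ω * (-(3 / 8 * (α t * κ * ‖X t ω‖ ^ 2))
        + 57 * (τ * α t ^ 2 * b ^ 2))) ℙ := hz.integrable (n := t) <|
      hG.comp₂ (hXp (by omega)) fun g x =>
        g * (-(3 / 8 * (α t * κ * ‖x‖ ^ 2)) + 57 * (τ * α t ^ 2 * b ^ 2))
    have hI2 : Integrable (fun ω => G ω *
        (lyapunov F R (level b κ p τ) α (t + k) (X (t + k) ω) (z (t + k) ω)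
        - lyapunov F R (level b κ p τ) α t (X t ω) (z t ω))) ℙ := hz.integrable (n := t + k) <|
      (hGk.comp₂ (hY le_rfl) (fun g x => (g, x))).comp₂ (hY (Nat.le_add_right t k))
        (fun q y => q.1 * (q.2 - y))
    have hI3 : Integrable (fun ω => ∑ w, K (z (t + k) ω) w * (G ω *
        (lyapunov F R (level b κ p τ) α (t + k + 1) (X (t + k + 1) ω) w
        - lyapunov F R (level b κ p τ) α t (X t ω) (z t ω)))) ℙ := hz.integrable (n := t + k) <|
      hH.comp₂ (Past.obs z le_rfl) fun f v => ∑ w, K v w * f w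
    calc _ ≤ ∫ ω, G ω *
            (lyapunov F R (level b κ p τ) α (t + k) (X (t + k) ω) (z (t + k) ω)
              - lyapunov F R (level b κ p τ) α t (X t ω) (z t ω))
            + G ω * (-(3 / 8 * (α t * κ * ‖X t ω‖ ^ 2)) + 57 * (τ * α t ^ 2 * b ^ 2)) ∂ℙ := by
          refine integral_mono hI3 (hI2.add hI) fun ω => ?_
          have hd := h.drift_in_block (x := fun n => X n ω) (z := fun n => z n ω)
            (fun n => hX n ω) t (k := k) (by omega)
          have hs : ∑ w, K (z (t + k) ω) w * (G ω *
              (lyapunov F R (level b κ p τ) α (t + k + 1) (X (t + k + 1) ω) w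
              - lyapunov F R (level b κ p τ) α t (X t ω) (z t ω)))
              = G ω * (∑ w, K (z (t + k) ω) w *
                lyapunov F R (level b κ p τ) α (t + k + 1) (X (t + k + 1) ω) w
                - lyapunov F R (level b κ p τ) α t (X t ω) (z t ω)) := by
            simp_rw [mul_left_comm _ (G ω), ← Finset.mul_sum]
            simp_rw [mul_sub (K _ _), Finset.sum_sub_distrib, ← Finset.sum_mul, h.K_sum, one_mul]
          simp only [hs, ← mul_add]
          refine mul_le_mul_of_nonneg_left ?_ (hG0 ω)
          linarith
      _ ≤ _ := by
          rw [integral_add hI2 hI]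
          push_cast
          linarith

/-- Moment bound for the Lyapunov function along the recursion. -/
theorem integral_lyapunov_rpow_le (h : SASetup F K μ R α b κ p τ) (hz : IsMarkovChain ℙ ν K z)
    (hX0 : ∀ ω, X 0 ω = x₀) (hX : ∀ n ω, X (n + 1) ω = X n ω + α n • F (X n ω) (z n ω))
    {D : ℝ} (hD : 64 * level b κ p τ ≤ D) (hD0 : 8 * ‖x₀‖ ^ 2 ≤ D * α 0) (t : ℕ) :
    ∫ ω, lyapunov F R (level b κ p τ) α t (X t ω) (z t ω) ^ p ∂ℙ ≤ (D * α t) ^ p := by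
  have hp := h.two_le_p
  have hp0 : 0 < p := by linarith
  have hL := h.level_pos
  have hDpos : 0 < D := by linarith
  have hI : ∀ {n : ℕ} (f : E → Z → ℝ), Integrable (fun ω => f (X n ω) (z n ω)) ℙ := fun {n} f =>
    hz.integrable (n := n) ((past_iterate hX0 hX (by omega)).comp₂ (Past.obs z le_rfl) f)
  induction t using Nat.strong_induction_on with
  | _ t ih =>
  rcases Nat.lt_or_ge t τ with htτ | htτ
  -- Before time `τ` there is no full block behind `t`; a pathwise comparison with time `0`
  -- suffices, as `Y` grows by at most a factor `3/2` and `α t ≥ (3/4) α 0`.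
  · have hpt : ∀ ω, lyapunov F R (level b κ p τ) α t (X t ω) (z t ω) ^ p ≤ (D * α t) ^ p := by
      intro ω
      refine Real.rpow_le_rpow (h.lyapunov_pos _ _ _).le ?_ hp0.le
      have h1 := (h.lyapunov_block (x := fun n => X n ω) (z := fun n => z n ω)
            (fun n => hX n ω) 0 htτ.le (z 0 ω) (z t ω)).1
      simp only [Nat.zero_add] at h1
      have h2 := (h.lyapunov_bounds 0 (X 0 ω) (z 0 ω)).2
      have h3 := h.lyapunov_pos 0 (X 0 ω) (z 0 ω)
      have h4 : lyapunov F R (level b κ p τ) α 0 (X 0 ω) (z 0 ω) / p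
          ≤ lyapunov F R (level b κ p τ) α 0 (X 0 ω) (z 0 ω) / 2 :=
        div_le_div_of_nonneg_left h3.le two_pos hp
      have h5 := (abs_le.1 h1).2
      rw [hX0] at h2 h3 h4 h5
      have h6 := h.α_sub_le_of_le 0 htτ.le
      rw [Nat.zero_add] at h6
      have h0 := h.α_pos 0
      have h7 : α 0 * (α 0 * τ * κ) ≤ α 0 * 1 :=
        mul_le_mul_of_nonneg_left (by linarith [h.β_le 0, h.δ_le 0]) h0.le
      have h8 : D * (3 / 4 * α 0) ≤ D * α t := mul_le_mul_of_nonneg_left (by linarith) hDpos.le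
      have h9 := mul_le_mul_of_nonneg_right hD h0.le
      linarith
    calc _ ≤ ∫ _, (D * α t) ^ p ∂ℙ := integral_mono
          (hI fun x v => lyapunov F R (level b κ p τ) α t x v ^ p) (integrable_const _) hpt
      _ = _ := by simp
  · obtain ⟨s, rfl⟩ := Nat.exists_eq_add_of_le' htτ
    have hs := ih s (by have := h.one_le_τ; omega)
    set Y : Ω → ℝ := fun ω => lyapunov F R (level b κ p τ) α s (X s ω) (z s ω) with hYd
    set Y' : Ω → ℝ := fun ω =>
      lyapunov F R (level b κ p τ) α (s + τ) (X (s + τ) ω) (z (s + τ) ω) with hYd'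
    have hY0 : ∀ ω, 0 < Y ω := fun ω => h.lyapunov_pos _ _ _
    set β := α s * τ * κ with hβ
    have hβ0 : 0 < β := h.β_pos s
    set a := level b κ p τ * α s with ha
    have ha0 : 0 < a := mul_pos hL (h.α_pos s)
    set m := D * α s with hm
    have hm0 : 0 < m := mul_pos hDpos (h.α_pos s)
    have ham : a ≤ m / 64 := by
      have := mul_le_mul_of_nonneg_right hD (h.α_pos s).le
      rw [ha, hm]; linarith
    have hIp : Integrable (fun ω => Y ω ^ p) ℙ :=
      hI fun x v => lyapunov F R (level b κ p τ) α s x v ^ p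
    have hIq : Integrable (fun ω => Y ω ^ (p - 1)) ℙ :=
      hI fun x v => lyapunov F R (level b κ p τ) α s x v ^ (p - 1)
    have hYp : Past z (s + τ) Y := past_lyapunov hX0 hX _ (Nat.le_add_right s τ)
    have hYp' : Past z (s + τ) Y' := past_lyapunov hX0 hX _ le_rfl
    have hIc : Integrable (fun ω => Y ω ^ (p - 1) * (Y' ω - Y ω)) ℙ :=
      hz.integrable (hYp.comp₂ hYp' fun y y' => y ^ (p - 1) * (y' - y))
    have i1 : Integrable (fun ω => p * (Y ω ^ (p - 1) * (Y' ω - Y ω))) ℙ := hIc.const_mul p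
    have i2 : Integrable (fun ω => Y ω ^ p + p * (Y ω ^ (p - 1) * (Y' ω - Y ω))) ℙ := hIp.add i1
    have i3 : Integrable (fun ω => Y ω ^ p / 8) ℙ := hIp.div_const 8
    have i4 : Integrable (fun ω => a * Y ω ^ (p - 1)) ℙ := hIq.const_mul a
    have i5 : Integrable (fun ω => p * β * (Y ω ^ p / 8 + a * Y ω ^ (p - 1))) ℙ :=
      (i3.add i4).const_mul _
    have i6 : Integrable (fun ω => -(Y ω ^ p) / 4) ℙ := hIp.neg.div_const 4
    have i7 : Integrable (fun ω => 5 / 8 * (a * Y ω ^ (p - 1))) ℙ := i4.const_mul _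
    have i8 : Integrable (fun ω => (p - 1) * Y ω ^ p) ℙ := hIp.const_mul _
    have hA : ∫ ω, Y' ω ^ p ∂ℙ ≤ ∫ ω, Y ω ^ p ∂ℙ + p * ∫ ω, Y ω ^ (p - 1) * (Y' ω - Y ω) ∂ℙ
        + p * β * ((∫ ω, Y ω ^ p ∂ℙ) / 8 + a * ∫ ω, Y ω ^ (p - 1) ∂ℙ) := by
      have h1 : ∫ ω, Y' ω ^ p ∂ℙ ≤ ∫ ω, (Y ω ^ p + p * (Y ω ^ (p - 1) * (Y' ω - Y ω))
          + p * β * (Y ω ^ p / 8 + a * Y ω ^ (p - 1))) ∂ℙ :=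
        integral_mono (hz.integrable (hYp'.comp fun y => y ^ p))
          (i2.add i5)
          fun ω => (h.lyapunov_block (x := fun n => X n ω) (z := fun n => z n ω)
            (fun n => hX n ω) s le_rfl (z s ω) (z (s + τ) ω)).2
      refine h1.trans_eq ?_
      rw [integral_add i2 i5, integral_add hIp i1, integral_const_mul, integral_const_mul,
        integral_add i3 i4, integral_div, integral_const_mul]
    have hB : ∫ ω, Y ω ^ (p - 1) * (Y' ω - Y ω) ∂ℙ
        ≤ β * (-(∫ ω, Y ω ^ p ∂ℙ) / 4 + 5 / 8 * (a * ∫ ω, Y ω ^ (p - 1) ∂ℙ)) := by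
      have h1 := h.integral_mul_lyapunov_sub_le hz hX0 hX s (G := fun ω => Y ω ^ (p - 1))
        ((past_lyapunov hX0 hX _ le_rfl).comp fun y => y ^ (p - 1))
        (fun ω => Real.rpow_nonneg (hY0 ω).le _) le_rfl
      refine h1.trans ?_
      rw [← integral_const_mul]
      have h2 : β * (-(∫ ω, Y ω ^ p ∂ℙ) / 4 + 5 / 8 * (a * ∫ ω, Y ω ^ (p - 1) ∂ℙ))
          = ∫ ω, β * (-(Y ω ^ p) / 4 + 5 / 8 * (a * Y ω ^ (p - 1))) ∂ℙ := by
        rw [integral_const_mul, integral_add i6 i7,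
          integral_div, integral_neg, integral_const_mul, integral_const_mul]
      rw [h2]
      refine integral_mono
        (hI fun x v => τ * (lyapunov F R (level b κ p τ) α s x v ^ (p - 1) *
          (-(3 / 8 * (α s * κ * ‖x‖ ^ 2)) + 57 * (τ * α s ^ 2 * b ^ 2))))
        ((i6.add i7).const_mul _) fun ω => ?_
      have h3 : Y ω ^ p = Y ω ^ (p - 1) * Y ω := by
        rw [Real.rpow_sub_one (hY0 ω).ne']; field_simp [(hY0 ω).ne']
      have h4 : 0 ≤ Y ω ^ (p - 1) := Real.rpow_nonneg (hY0 ω).le _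
      have h5 : β * (2 / 3 * Y ω - a) ≤ β * ‖X s ω‖ ^ 2 :=
        mul_le_mul_of_nonneg_left
          (by linarith [(h.lyapunov_bounds s (X s ω) (z s ω)).2]) hβ0.le
      have h6 : 57 * (α s * τ * b) ^ 2 ≤ β * a / 4 := by
        have e1 := h.p_δ_sq_eq s
        have e2 : 2 * (α s * τ * b) ^ 2 ≤ p * (α s * τ * b) ^ 2 :=
          mul_le_mul_of_nonneg_right hp (sq_nonneg _)
        have e3 := sq_nonneg (α s * τ * b)
        linarith
      have h7 : τ * (-(3 / 8 * (α s * κ * ‖X s ω‖ ^ 2)) + 57 * (τ * α s ^ 2 * b ^ 2))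
          ≤ β * (-(Y ω) / 4 + 5 / 8 * a) := by
        have : τ * (-(3 / 8 * (α s * κ * ‖X s ω‖ ^ 2)) + 57 * (τ * α s ^ 2 * b ^ 2))
          = -(3 / 8) * (β * ‖X s ω‖ ^ 2) + 57 * (α s * τ * b) ^ 2 := by rw [hβ]; ring
        rw [this]
        linarith
      have h8 := mul_le_mul_of_nonneg_left h7 h4
      simp only [h3]
      linarith
    -- Young's inequality against the constant `m` combined with the induction hypothesis gives the
    -- moment of order `p - 1`.
    have hC : (∫ ω, Y ω ^ (p - 1) ∂ℙ) * m ≤ m ^ p := by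
      have h1 : ∫ ω, Y ω ^ (p - 1) * m ∂ℙ ≤ ∫ ω, ((p - 1) * Y ω ^ p + m ^ p) / p ∂ℙ :=
        integral_mono (hIq.mul_const m) ((i8.add (integrable_const _)).div_const p)
          fun ω => rpow_sub_one_mul_le (by linarith) (hY0 ω).le hm0.le
      rw [integral_mul_const, integral_div, integral_add i8 (integrable_const _),
        integral_const_mul, integral_const, probReal_univ, one_smul] at h1
      refine h1.trans ?_
      rw [div_le_iff₀ hp0]
      have := mul_le_mul_of_nonneg_left hs (by linarith : 0 ≤ p - 1)
      linarith
    have hN0 : 0 ≤ ∫ ω, Y ω ^ (p - 1) ∂ℙ :=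
      integral_nonneg fun ω => Real.rpow_nonneg (hY0 ω).le _
    have hQ0 : 0 < m ^ p := Real.rpow_pos_of_pos hm0 _
    have hpβ : p * β ≤ 1 := by
      have := mul_le_mul_of_nonneg_left (h.β_le s) hp0.le
      linarith [h.p_δ_le s]
    have hβ1 : β ≤ 1 := by linarith [h.β_le s, h.δ_le s]
    -- The target shrinks by at most `(1 - β / 32) ^ p ≥ 1 - p * β / 32` over the block (Bernoulli),
    -- slower than the contraction obtained.
    have hfin : m ^ p * (1 - 3 / 32 * (p * β)) ≤ (D * α (s + τ)) ^ p := by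
      have h1 : α s * (1 - β / 32) ≤ α (s + τ) := by
        have := h.α_sub_le_of_le s (le_refl τ)
        rw [hβ]; linarith
      have h2 : m * (1 - β / 32) ≤ D * α (s + τ) := by
        rw [hm, mul_assoc]; exact mul_le_mul_of_nonneg_left h1 hDpos.le
      have h3 : 1 + p * (-(β / 32)) ≤ (1 + -(β / 32)) ^ p :=
        one_add_mul_self_le_rpow_one_add (by linarith) (by linarith)
      calc m ^ p * (1 - 3 / 32 * (p * β)) ≤ m ^ p * (1 - β / 32) ^ p := by
            refine mul_le_mul_of_nonneg_left ?_ hQ0.le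
            rw [← sub_eq_add_neg] at h3
            have := mul_pos hp0 hβ0
            linarith
        _ = (m * (1 - β / 32)) ^ p := (Real.mul_rpow hm0.le (by linarith)).symm
        _ ≤ _ := Real.rpow_le_rpow (mul_nonneg hm0.le (by linarith)) h2 hp0.le
    refine le_trans ?_ hfin
    have hB' := mul_le_mul_of_nonneg_left hB hp0.le
    -- In units of `p * β * m ^ p`, the contraction is `1/4 - 1/8` and the noise is `(5/8 + 1) /
    -- 64`, which leaves at least `3/32`.
    have haN : a * ∫ ω, Y ω ^ (p - 1) ∂ℙ ≤ m ^ p / 64 := by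
      have := mul_le_mul_of_nonneg_right ham hN0
      linarith
    have hpβ0 := mul_pos hp0 hβ0
    have h1 := mul_le_mul_of_nonneg_left haN hpβ0.le
    have h2 := mul_le_mul_of_nonneg_left hs (by linarith : 0 ≤ 1 - p * β / 8)
    have h3 : 0 ≤ p * β * m ^ p := by positivity
    change ∫ ω, Y' ω ^ p ∂ℙ ≤ _
    clear * - hA hB' h1 h2 h3
    linarith

end SASetup

/-! ### The Q-learning field: growth, Lipschitz bound and mean drift -/

namespace Model

section

variable {S A : Type*} [Fintype S] [Fintype A] {d : ℕ} (M : Model S A d)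

theorem Q_eq_inner (θ : Param d) (s : S) (a : A) : M.Q θ s a = inner ℝ (M.φ s a) θ := by
  simp [Q, PiLp.inner_apply, mul_comm]

theorem abs_Q_le (hφ : ∀ s a, ‖M.φ s a‖ ≤ 1) (θ : Param d) (s : S) (a : A) :
    |M.Q θ s a| ≤ ‖θ‖ := by
  rw [Q_eq_inner]
  exact (abs_real_inner_le_norm _ _).trans (mul_le_of_le_one_left (norm_nonneg _) (hφ s a))

theorem Q_sub (θ θ' : Param d) (s : S) (a : A) :
    M.Q (θ - θ') s a = M.Q θ s a - M.Q θ' s a := by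
  simp [Q_eq_inner, inner_sub_right]

theorem sum_exp_pos [Nonempty A] (θ : Param d) (s : S) :
    0 < ∑ a, Real.exp (M.Q θ s a / M.lam) :=
  Finset.sum_pos (fun _ _ => Real.exp_pos _) Finset.univ_nonempty

/-- Log-sum-exp is monotone and commutes with adding a constant, hence nonexpansive in the sup norm,
where `Q` moves by at most `‖θ - θ'‖`. -/
theorem V_le_add [Nonempty A] (hφ : ∀ s a, ‖M.φ s a‖ ≤ 1) (θ θ' : Param d) (s : S) :
    M.V θ s ≤ M.V θ' s + ‖θ - θ'‖ := by
  have hl := M.lam_pos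
  have h1 : ∑ a, Real.exp (M.Q θ s a / M.lam)
      ≤ Real.exp (‖θ - θ'‖ / M.lam) * ∑ a, Real.exp (M.Q θ' s a / M.lam) := by
    rw [Finset.mul_sum]
    refine Finset.sum_le_sum fun a _ => ?_
    rw [← Real.exp_add, ← add_div]
    refine Real.exp_le_exp.2 (div_le_div_of_nonneg_right ?_ hl.le)
    have := le_of_abs_le (M.abs_Q_le hφ (θ - θ') s a)
    rw [Q_sub] at this
    linarith
  have h2 := Real.log_le_log (M.sum_exp_pos θ s) h1
  rw [Real.log_mul (Real.exp_ne_zero _) (M.sum_exp_pos θ' s).ne', Real.log_exp] at h2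
  have h3 := mul_le_mul_of_nonneg_left h2 hl.le
  rw [mul_add, mul_div_cancel₀ _ hl.ne'] at h3
  unfold V
  linarith

theorem abs_V_sub_le [Nonempty A] (hφ : ∀ s a, ‖M.φ s a‖ ≤ 1) (θ θ' : Param d) (s : S) :
    |M.V θ s - M.V θ' s| ≤ ‖θ - θ'‖ := by
  rw [abs_sub_le_iff]
  constructor
  · linarith [M.V_le_add hφ θ θ' s]
  · have := M.V_le_add hφ θ' θ s
    rw [norm_sub_rev] at this
    linarith

theorem V_zero (s : S) : M.V 0 s = M.lam * Real.log (Fintype.card A) := by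
  simp [V, Q]

theorem abs_V_le [Nonempty A] (hφ : ∀ s a, ‖M.φ s a‖ ≤ 1) (θ : Param d) (s : S) :
    |M.V θ s| ≤ ‖θ‖ + M.lam * Real.log (Fintype.card A) := by
  have h1 := M.abs_V_sub_le hφ θ 0 s
  rw [V_zero, sub_zero] at h1
  have h2 : 0 ≤ M.lam * Real.log (Fintype.card A) :=
    mul_nonneg M.lam_pos.le (Real.log_natCast_nonneg _)
  have h3 := abs_le.1 h1
  rw [abs_le]
  constructor <;> linarith

theorem norm_F_sub_le [Nonempty A] (hφ : ∀ s a, ‖M.φ s a‖ ≤ 1) (θ θ' : Param d) (v : Obs S A) :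
    ‖M.F θ v - M.F θ' v‖ ≤ (1 + M.γ) * ‖θ - θ'‖ := by
  unfold F
  rw [← sub_smul, norm_smul, Real.norm_eq_abs]
  refine (mul_le_of_le_one_right (abs_nonneg _) (hφ _ _)).trans ?_
  have h1 := M.abs_V_sub_le hφ θ θ' v.2.2
  have h2 := M.abs_Q_le hφ (θ - θ') v.1 v.2.1
  rw [Q_sub] at h2
  have hγ := M.γ_mem.1
  have e : M.r v.1 v.2.1 + M.γ * M.V θ v.2.2 - M.Q θ v.1 v.2.1
      - (M.r v.1 v.2.1 + M.γ * M.V θ' v.2.2 - M.Q θ' v.1 v.2.1)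
      = M.γ * (M.V θ v.2.2 - M.V θ' v.2.2) - (M.Q θ v.1 v.2.1 - M.Q θ' v.1 v.2.1) := by ring
  rw [e]
  refine (abs_sub _ _).trans ?_
  rw [abs_mul, abs_of_pos hγ]
  have := mul_le_mul_of_nonneg_left h1 hγ.le
  linarith

theorem norm_F_le [Nonempty A] (hφ : ∀ s a, ‖M.φ s a‖ ≤ 1) (θ : Param d) (v : Obs S A) :
    ‖M.F θ v‖ ≤ M.epsMax θ := by
  unfold F
  rw [norm_smul, Real.norm_eq_abs]
  refine (mul_le_of_le_one_right (abs_nonneg _) (hφ _ _)).trans ?_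
  have h1 := M.abs_V_le hφ θ v.2.2
  have h2 := M.abs_Q_le hφ θ v.1 v.2.1
  have h3 := M.r_mem v.1 v.2.1
  have hγ := M.γ_mem.1
  refine (abs_sub _ _).trans ((add_le_add (abs_add_le _ _) le_rfl).trans ?_)
  rw [abs_mul, abs_of_pos hγ, abs_of_nonneg h3.1]
  have := mul_le_mul_of_nonneg_left h1 hγ.le
  unfold epsMax
  linarith [h3.2]

theorem one_le_epsMax (θ : Param d) : 1 ≤ M.epsMax θ := by
  have hγ := M.γ_mem.1
  have : 0 ≤ (1 + M.γ) * ‖θ‖ := by positivity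
  have : 0 ≤ M.γ * M.lam * Real.log (Fintype.card A) :=
    mul_nonneg (mul_pos hγ M.lam_pos).le (Real.log_natCast_nonneg _)
  unfold epsMax
  linarith

theorem eight_le_Cxi (θ : Param d) : 8 ≤ M.Cxi θ := by
  refine le_trans ?_ (le_max_right _ _)
  have := M.γ_mem.1
  nlinarith

theorem epsMax_le_sqrt_Cxi (θ : Param d) : M.epsMax θ ≤ √(M.Cxi θ) := by
  refine Real.le_sqrt_of_sq_le (le_trans ?_ (le_max_left _ _))
  nlinarith [sq_nonneg (M.epsMax θ)]

theorem one_add_γ_le_sqrt_Cxi (θ : Param d) : 1 + M.γ ≤ √(M.Cxi θ) := by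
  refine Real.le_sqrt_of_sq_le (le_trans ?_ (le_max_right _ _))
  nlinarith [sq_nonneg (1 + M.γ)]

theorem softPolicy_nonneg (θ : Param d) (s : S) (a : A) : 0 ≤ M.softPolicy θ s a := by
  unfold softPolicy
  positivity

theorem sum_softPolicy [Nonempty A] (θ : Param d) (s : S) : ∑ a, M.softPolicy θ s a = 1 := by
  unfold softPolicy
  rw [← Finset.sum_div, div_self (M.sum_exp_pos θ s).ne']

theorem hasDerivAt_V [Nonempty A] (θ x : Param d) (s : S) (u : ℝ) :
    HasDerivAt (fun u : ℝ => M.V (θ + u • x) s)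
      (∑ a, M.softPolicy (θ + u • x) s a * M.Q x s a) u := by
  have hl := M.lam_pos.ne'
  have hQ : ∀ a, HasDerivAt (fun u : ℝ => M.Q (θ + u • x) s a) (M.Q x s a) u := fun a => by
    have e : (fun u : ℝ => M.Q (θ + u • x) s a) = fun u => M.Q θ s a + u * M.Q x s a := by
      funext u
      simp [Q_eq_inner, inner_add_right, inner_smul_right]
    rw [e]
    simpa using ((hasDerivAt_id u).mul_const (M.Q x s a)).const_add (M.Q θ s a)
  have h1 := HasDerivAt.fun_sum (u := Finset.univ) fun a _ => ((hQ a).div_const M.lam).exp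
  have h2 := (h1.log (M.sum_exp_pos (θ + u • x) s).ne').const_mul M.lam
  refine HasDerivAt.congr_deriv (f := fun u : ℝ => M.V (θ + u • x) s) h2 ?_
  symm
  rw [← mul_div_assoc, Finset.mul_sum, Finset.sum_div]
  refine Finset.sum_congr rfl fun a _ => ?_
  unfold softPolicy
  field_simp

open Matrix in
theorem dotProduct_featGram (s : S) (a : A) (x : Param d) :
    (x : Fin d → ℝ) ⬝ᵥ (M.featGram s a *ᵥ (x : Fin d → ℝ)) = M.Q x s a ^ 2 := by
  simp only [featGram, dotProduct, mulVec, Matrix.of_apply, Q, sq, Finset.mul_sum, Finset.sum_mul]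
  refine Finset.sum_congr rfl fun i _ => Finset.sum_congr rfl fun j _ => ?_
  ring

open Matrix in
theorem dotProduct_sum_smul {ι n : Type*} [Fintype n] (s : Finset ι) (w : ι → ℝ)
    (G : ι → Matrix n n ℝ) (x : n → ℝ) :
    x ⬝ᵥ ((∑ i ∈ s, w i • G i) *ᵥ x) = ∑ i ∈ s, w i * (x ⬝ᵥ (G i *ᵥ x)) := by
  rw [Matrix.sum_mulVec, dotProduct_sum]
  simp [Matrix.smul_mulVec, dotProduct_smul]

open Matrix in
theorem FeatureCondition.le {M : Model S A d} {μ : Obs S A → ℝ} {κ : ℝ}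
    (h : M.FeatureCondition μ κ) (θ x : Param d) :
    κ * ‖x‖ ^ 2 ≤ ∑ v, μ v * M.Q x v.1 v.2.1 ^ 2
      - M.γ ^ 2 * ∑ v, μ v * ∑ a, M.softPolicy θ v.1 a * M.Q x v.1 a ^ 2 := by
  have h1 := (h.2.2 θ).dotProduct_mulVec_nonneg (x : Fin d → ℝ)
  rw [star_trivial, sub_mulVec, sub_mulVec, dotProduct_sub, dotProduct_sub, smul_mulVec,
    smul_mulVec, dotProduct_smul, dotProduct_smul, one_mulVec, covBehavior, covSoft,
    dotProduct_sum_smul, dotProduct_sum_smul] at h1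
  simp_rw [dotProduct_sum_smul, dotProduct_featGram, smul_eq_mul] at h1
  have h2 : (x : Fin d → ℝ) ⬝ᵥ (x : Fin d → ℝ) = ‖x‖ ^ 2 := by
    rw [EuclideanSpace.real_norm_sq_eq]
    simp [dotProduct, sq]
  rw [h2] at h1
  linarith

end

section

variable {S A : Type*} [Fintype S] [Fintype A] [DecidableEq S] {d : ℕ} (M : Model S A d)

theorem obsKernel_nonneg (v w : Obs S A) : 0 ≤ M.obsKernel v w := by
  unfold obsKernel
  rw [Matrix.of_apply]
  split_ifs
  · exact mul_nonneg ((M.πb_mem _).1 _) ((M.P_mem _ _).1 _)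
  · exact le_rfl

theorem sum_obsKernel_mul (v : Obs S A) (f : S → ℝ) :
    ∑ w, M.obsKernel v w * f w.1 = f v.2.2 := by
  simp_rw [Fintype.sum_prod_type, obsKernel, Matrix.of_apply]
  rw [Finset.sum_eq_single v.2.2]
  · simp_rw [if_true, ← Finset.sum_mul, ← Finset.mul_sum, (M.P_mem _ _).2, mul_one,
      (M.πb_mem _).2, one_mul]
  · intro s _ hs
    simp [hs]
  · simp

theorem sum_obsKernel (v : Obs S A) : ∑ w, M.obsKernel v w = 1 := by
  simpa using M.sum_obsKernel_mul v fun _ => 1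

variable {M} {μ : Obs S A → ℝ}

/-- The next observation starts at `s'`, so by stationarity `s` and `s'` have the same law under
`μ`. -/
theorem sum_stationary (h : IsStationary M.obsKernel μ) (f : S → ℝ) :
    ∑ v, μ v * f v.2.2 = ∑ v, μ v * f v.1 := by
  conv_rhs => rw [← h.2]
  simp_rw [Matrix.vecMul, dotProduct, Finset.sum_mul]
  rw [Finset.sum_comm]
  simp_rw [mul_assoc, ← Finset.mul_sum, sum_obsKernel_mul]

theorem exists_stationary_eq (h : IsStationary M.obsKernel μ) :
    ∃ ν : S → ℝ, ∀ s a s', μ (s, a, s') = ν s * M.πb s a * M.P s a s' := by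
  refine ⟨fun s => ∑ v, if s = v.2.2 then μ v else 0, fun s a s' => ?_⟩
  conv_lhs => rw [← h.2]
  simp only [Matrix.vecMul, dotProduct, obsKernel, Matrix.of_apply, Finset.sum_mul]
  refine Finset.sum_congr rfl fun v _ => ?_
  split_ifs <;> ring

/-- Stationarity factorizes `μ` as `ν(s) π_b(a ∣ s) P(s' ∣ s, a)`. This trades the sampled value at
`s'` in `F` for its conditional mean in the Bellman residual. -/
theorem sum_stationary_transition (h : IsStationary M.obsKernel μ) (g : S → A → ℝ) (f : S → ℝ) :
    ∑ v, μ v * (g v.1 v.2.1 * f v.2.2)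
      = ∑ v, μ v * (g v.1 v.2.1 * ∑ s', M.P v.1 v.2.1 s' * f s') := by
  obtain ⟨ν, hν⟩ := exists_stationary_eq h
  simp_rw [Fintype.sum_prod_type, hν]
  refine Finset.sum_congr rfl fun s _ => Finset.sum_congr rfl fun a _ => ?_
  rw [← Finset.sum_mul, ← Finset.mul_sum, (M.P_mem s a).2, mul_one, Finset.mul_sum,
    Finset.mul_sum]
  refine Finset.sum_congr rfl fun s' _ => ?_
  ring

theorem sum_inner_F_root (h : IsStationary M.obsKernel μ) {θs : Param d}
    (hθ : M.SolvesProjectedBellman μ θs) (x : Param d) :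
    ∑ v, μ v * inner ℝ x (M.F θs v) = 0 := by
  have hmem : (fun s a => M.Q x s a) ∈ M.featSpan := by
    have : (fun s a => M.Q x s a) = ∑ k, x k • fun (s : S) (a : A) => M.φ s a k := by
      funext s a
      simp only [Q, Finset.sum_apply, Pi.smul_apply, smul_eq_mul]
      exact Finset.sum_congr rfl fun k _ => mul_comm _ _
    rw [this]
    exact Submodule.sum_mem _ fun k _ => Submodule.smul_mem _ _ (Submodule.subset_span ⟨k, rfl⟩)
  have h0 := hθ.2 _ hmem
  have h1 := sum_stationary_transition h (fun s a => M.γ * M.Q x s a) (M.V θs)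
  have h2 : ∀ v : Obs S A, μ v * inner ℝ x (M.F θs v)
      = μ v * ((M.r v.1 v.2.1 - M.Q θs v.1 v.2.1) * M.Q x v.1 v.2.1)
        + μ v * (M.γ * M.Q x v.1 v.2.1 * M.V θs v.2.2) := fun v => by
    rw [F, inner_smul_right, real_inner_comm, ← Q_eq_inner]
    ring
  simp_rw [h2, Finset.sum_add_distrib]
  rw [h1, ← Finset.sum_add_distrib, ← h0]
  refine Finset.sum_congr rfl fun v _ => ?_
  simp only [residual, Pi.zero_apply]
  ring

/-- The cross term is split by `q * (γ Q) ≤ q² / 2 + γ² Q² / 2`. Moving the second half from `s'` to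
`s` by stationarity leaves `-1/2` times the quadratic form of the feature condition, hence the rate
`κ / 2`. -/
theorem sum_inner_F_le [Nonempty A] (h : IsStationary M.obsKernel μ) {θs : Param d} {κ : ℝ}
    (hκ : M.FeatureCondition μ κ) (hθ : M.SolvesProjectedBellman μ θs) (x : Param d) :
    ∑ v, μ v * inner ℝ x (M.F (θs + x) v) ≤ -(κ / 2) * ‖x‖ ^ 2 := by
  set q : Obs S A → ℝ := fun v => M.Q x v.1 v.2.1 with hq
  have hder : ∀ u : ℝ, HasDerivAt (fun u : ℝ => ∑ v, μ v * q v * M.γ * M.V (θs + u • x) v.2.2)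
      (∑ v, μ v * q v * M.γ * ∑ a, M.softPolicy (θs + u • x) v.2.2 a * M.Q x v.2.2 a) u :=
    fun u => HasDerivAt.fun_sum fun v _ => (M.hasDerivAt_V θs x v.2.2 u).const_mul _
  -- The mean value theorem is applied to the whole `μ`-average, not observation by observation: the
  -- feature condition concerns a single policy, so one `u` must serve every `v`.
  obtain ⟨u, -, hu⟩ := exists_hasDerivAt_eq_slope _ _ (zero_lt_one' ℝ)
    (fun u _ => (hder u).continuousAt.continuousWithinAt) (fun u _ => hder u)
  simp only [one_smul, zero_smul, add_zero, sub_zero, div_one] at hu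
  have e1 : ∑ v, μ v * inner ℝ x (M.F (θs + x) v)
      = ∑ v, μ v * inner ℝ x (M.F θs v)
        + (∑ v, μ v * q v * M.γ * M.V (θs + x) v.2.2 - ∑ v, μ v * q v * M.γ * M.V θs v.2.2)
        - ∑ v, μ v * q v ^ 2 := by
    rw [← Finset.sum_sub_distrib, ← Finset.sum_add_distrib, ← Finset.sum_sub_distrib]
    refine Finset.sum_congr rfl fun v _ => ?_
    have e2 : M.Q (θs + x) v.1 v.2.1 = M.Q θs v.1 v.2.1 + M.Q x v.1 v.2.1 := by
      simp [Q_eq_inner, inner_add_right]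
    rw [F, F, inner_smul_right, inner_smul_right, real_inner_comm, ← Q_eq_inner, e2]
    ring
  rw [e1, sum_inner_F_root h hθ x, ← hu]
  set θ := θs + u • x
  have e3 : ∑ v, μ v * q v * M.γ * ∑ a, M.softPolicy θ v.2.2 a * M.Q x v.2.2 a
      ≤ ∑ v, μ v * (q v ^ 2 / 2
        + M.γ ^ 2 / 2 * ∑ a, M.softPolicy θ v.2.2 a * M.Q x v.2.2 a ^ 2) := by
    refine Finset.sum_le_sum fun v _ => ?_
    rw [mul_assoc, mul_assoc]
    refine mul_le_mul_of_nonneg_left ?_ (h.1.1 v)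
    calc q v * (M.γ * ∑ a, M.softPolicy θ v.2.2 a * M.Q x v.2.2 a)
        = ∑ a, M.softPolicy θ v.2.2 a * (q v * (M.γ * M.Q x v.2.2 a)) := by
          simp_rw [Finset.mul_sum]
          exact Finset.sum_congr rfl fun a _ => by ring
      _ ≤ ∑ a, M.softPolicy θ v.2.2 a * (q v ^ 2 / 2 + M.γ ^ 2 / 2 * M.Q x v.2.2 a ^ 2) := by
          refine Finset.sum_le_sum fun a _ =>
            mul_le_mul_of_nonneg_left ?_ (M.softPolicy_nonneg _ _ _)
          linarith [sq_nonneg (q v - M.γ * M.Q x v.2.2 a)]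
      _ = _ := by
          simp_rw [mul_add, Finset.sum_add_distrib]
          rw [← Finset.sum_mul, sum_softPolicy, one_mul, Finset.mul_sum]
          congr 1
          exact Finset.sum_congr rfl fun a _ => by ring
  have e4 := sum_stationary h fun s => ∑ a, M.softPolicy θ s a * M.Q x s a ^ 2
  have e5 := hκ.le θ x
  have e6 : ∑ v, μ v * (q v ^ 2 / 2
        + M.γ ^ 2 / 2 * ∑ a, M.softPolicy θ v.2.2 a * M.Q x v.2.2 a ^ 2)
      = (∑ v, μ v * q v ^ 2) / 2
        + M.γ ^ 2 / 2 * ∑ v, μ v * ∑ a, M.softPolicy θ v.1 a * M.Q x v.1 a ^ 2 := by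
    rw [← e4, Finset.mul_sum, Finset.sum_div, ← Finset.sum_add_distrib]
    exact Finset.sum_congr rfl fun v _ => by ring
  rw [e6] at e3
  linarith

-- A unit coordinate vector is tested; its existence is where `0 < d` enters.
omit [DecidableEq S] in
theorem FeatureCondition.le_one (hμ : μ ∈ stdSimplex ℝ (Obs S A)) {κ : ℝ}
    (h : M.FeatureCondition μ κ) (hd : 0 < d) : κ ≤ 1 := by
  have h1 := h.le 0 (EuclideanSpace.single ⟨0, hd⟩ (1 : ℝ))
  set x : Param d := EuclideanSpace.single ⟨0, hd⟩ (1 : ℝ)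
  have hx : ‖x‖ = 1 := by simp [x]
  have h2 : ∑ v, μ v * M.Q x v.1 v.2.1 ^ 2 ≤ ∑ v, μ v * 1 := by
    refine Finset.sum_le_sum fun v _ => mul_le_mul_of_nonneg_left ?_ (hμ.1 v)
    have := M.abs_Q_le h.2.1 x v.1 v.2.1
    rw [hx] at this
    exact (sq_le_one_iff_abs_le_one _).2 this
  have h3 : 0 ≤ ∑ v, μ v * ∑ a, M.softPolicy 0 v.1 a * M.Q x v.1 a ^ 2 :=
    Finset.sum_nonneg fun v _ => mul_nonneg (hμ.1 v) (Finset.sum_nonneg fun a _ =>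
      mul_nonneg (M.softPolicy_nonneg _ _ _) (sq_nonneg _))
  have h4 := mul_nonneg (sq_nonneg M.γ) h3
  simp only [mul_one, hμ.2] at h2
  rw [hx] at h1
  linarith

end

end Model

/-! ### Step sizes -/

section StepSize

variable {c₀ k₀ ω : ℝ}

theorem stepSize_pos (hc : 0 < c₀) (hk : 0 < k₀) (t : ℕ) : 0 < stepSize c₀ k₀ ω t := by
  unfold stepSize
  positivity

theorem stepSize_antitone (hc : 0 < c₀) (hk : 0 < k₀) (hω : 0 ≤ ω) :
    Antitone (stepSize c₀ k₀ ω) := by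
  intro s t hst
  have hst' : (s : ℝ) ≤ t := by exact_mod_cast hst
  unfold stepSize
  gcongr

theorem stepSize_mul (hk : 0 < k₀) (t : ℕ) :
    stepSize c₀ k₀ ω t * (t + k₀) = c₀ * ((t : ℝ) + k₀) ^ (1 - ω) := by
  have : 0 < (t : ℝ) + k₀ := by positivity
  rw [stepSize, Real.rpow_sub this, Real.rpow_one]
  ring

theorem le_stepSize_mul {κ : ℝ} (hc : 0 < c₀) (hk : 0 < k₀) (hω : ω ≤ 1) (hκ : 0 < κ)
    (h : 32 / (κ * c₀) ≤ k₀ ^ (1 - ω)) (t : ℕ) : 32 / κ ≤ stepSize c₀ k₀ ω t * (t + k₀) := by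
  rw [stepSize_mul hk]
  calc 32 / κ = c₀ * (32 / (κ * c₀)) := by field_simp
    _ ≤ c₀ * k₀ ^ (1 - ω) := mul_le_mul_of_nonneg_left h hc.le
    _ ≤ _ := by
      have : k₀ ≤ (t : ℝ) + k₀ := by linarith [(Nat.cast_nonneg t : (0 : ℝ) ≤ t)]
      have h1 : k₀ ^ (1 - ω) ≤ ((t : ℝ) + k₀) ^ (1 - ω) :=
        Real.rpow_le_rpow hk.le this (by linarith)
      exact mul_le_mul_of_nonneg_left h1 hc.le

/-- With `u = t + k₀`, the exponent `ω ≤ 1` makes the decrement at most `α_t / u`, and the condition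
on `k₀` says `α_t u ≥ 32 / κ`. -/
theorem stepSize_sub_le {κ : ℝ} (hc : 0 < c₀) (hk : 0 < k₀) (hω : ω ≤ 1) (hκ : 0 < κ)
    (h : 32 / (κ * c₀) ≤ k₀ ^ (1 - ω)) (t : ℕ) :
    stepSize c₀ k₀ ω t - stepSize c₀ k₀ ω (t + 1) ≤ stepSize c₀ k₀ ω t ^ 2 * (κ / 32) := by
  have hα := stepSize_pos (ω := ω) hc hk t
  have hu := le_stepSize_mul hc hk hω hκ h t
  set a := stepSize c₀ k₀ ω t with ha
  set u := (t : ℝ) + k₀ with hud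
  have hu0 : 0 < u := by positivity
  have h1 : a * (u / (u + 1)) ≤ stepSize c₀ k₀ ω (t + 1) := by
    have e : ((t + 1 : ℕ) : ℝ) + k₀ = u + 1 := by push_cast; ring
    rw [ha, stepSize, stepSize, e, ← hud]
    have h2 : u / (u + 1) ≤ (u / (u + 1)) ^ ω := by
      have := Real.rpow_le_rpow_of_exponent_ge (x := u / (u + 1)) (by positivity)
        ((div_le_one (by positivity)).2 (by linarith)) hω
      rwa [Real.rpow_one] at this
    rw [Real.div_rpow hu0.le (by positivity)] at h2
    have h3 : 0 < u ^ ω := by positivity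
    have h4 : 0 < (u + 1) ^ ω := by positivity
    calc c₀ / u ^ ω * (u / (u + 1)) ≤ c₀ / u ^ ω * (u ^ ω / (u + 1) ^ ω) := by gcongr
      _ = _ := by field_simp
  have h2 : a * (u / (u + 1)) = a - a / (u + 1) := by field_simp; ring
  have h3 : a / (u + 1) ≤ a / u := div_le_div_of_nonneg_left hα.le hu0 (by linarith)
  have h4 : a / u ≤ a ^ 2 * (κ / 32) := by
    rw [div_le_iff₀ hu0]
    rw [div_le_iff₀ hκ] at hu
    have := mul_le_mul_of_nonneg_left hu hα.le
    linarith
  linarith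

theorem summable_stepSize_sq (hk : 0 < k₀) (hω : 1 / 2 < ω) :
    Summable fun j : ℕ => stepSize c₀ k₀ ω j ^ 2 := by
  have h1 : Summable fun j : ℕ => c₀ ^ 2 * (1 / (((j + 1 : ℕ) : ℝ)) ^ (2 * ω)) :=
    ((summable_nat_add_iff 1).2 (Real.summable_one_div_nat_rpow.2 (by linarith))).mul_left _
  rw [← summable_nat_add_iff 1]
  refine Summable.of_nonneg_of_le (fun _ => sq_nonneg _) (fun j => ?_) h1
  rw [stepSize, div_pow, ← Real.rpow_mul_natCast (by positivity), mul_comm ω, div_eq_mul_one_div]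
  refine mul_le_mul_of_nonneg_left ?_ (sq_nonneg _)
  have h2 : ((j + 1 : ℕ) : ℝ) ≤ ((j + 1 : ℕ) : ℝ) + k₀ := by linarith
  push_cast at h2 ⊢
  gcongr

/-- For `j ≤ k₀` one has `α_j ≥ α₀ / 2`, and there are at least `k₀` such indices, so the series is
at least `k₀ α₀² / 4`; then `α₀ k₀ ≥ 32 / κ`. -/
theorem le_Comega {κ : ℝ} (hc : 0 < c₀) (hk : 0 < k₀) (hω : ω ∈ Set.Ioo (1 / 2 : ℝ) 1)
    (hκ : 0 < κ) (h : 32 / (κ * c₀) ≤ k₀ ^ (1 - ω)) :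
    8 * stepSize c₀ k₀ ω 0 / κ ≤ Comega c₀ k₀ ω := by
  have hα := stepSize_pos (ω := ω) hc hk 0
  have hu := le_stepSize_mul hc hk hω.2.le hκ h 0
  set a := stepSize c₀ k₀ ω 0 with ha
  have h1 : ∀ j ∈ Finset.range (⌊k₀⌋₊ + 1), (a / 2) ^ 2 ≤ stepSize c₀ k₀ ω j ^ 2 := by
    intro j hj
    have hjk : (j : ℝ) ≤ k₀ :=
      (Nat.le_floor_iff hk.le).1 (Nat.lt_succ_iff.1 (Finset.mem_range.1 hj))
    refine pow_le_pow_left₀ (by positivity) ?_ 2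
    rw [ha, stepSize, stepSize, div_div]
    refine div_le_div_of_nonneg_left hc.le (by positivity) ?_
    calc ((j : ℝ) + k₀) ^ ω ≤ (2 * k₀) ^ ω :=
          Real.rpow_le_rpow (by positivity) (by linarith) (by linarith [hω.1])
      _ = k₀ ^ ω * 2 ^ ω := by rw [Real.mul_rpow (by norm_num) hk.le, mul_comm]
      _ ≤ k₀ ^ ω * 2 := by
          refine mul_le_mul_of_nonneg_left ?_ (by positivity)
          have := Real.rpow_le_rpow_of_exponent_le (x := 2) (by norm_num) hω.2.le
          rwa [Real.rpow_one] at this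
      _ = _ := by simp
  have h2 := (summable_stepSize_sq (c₀ := c₀) hk hω.1).sum_le_tsum
    (Finset.range (⌊k₀⌋₊ + 1)) fun _ _ => sq_nonneg _
  have h3 := Finset.card_nsmul_le_sum _ _ _ h1
  rw [Finset.card_range, nsmul_eq_mul] at h3
  have h4 : k₀ ≤ ((⌊k₀⌋₊ + 1 : ℕ) : ℝ) := by
    push_cast
    exact (Nat.lt_floor_add_one k₀).le
  have h5 := mul_le_mul_of_nonneg_right h4 (sq_nonneg (a / 2))
  unfold Comega
  refine le_trans ?_ (h3.trans h2)
  refine le_trans ?_ h5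
  have h6 := mul_le_mul_of_nonneg_left hu hα.le
  simp only [Nat.cast_zero, zero_add] at h6
  calc 8 * a / κ = a * (32 / κ) / 4 := by ring
    _ ≤ a * (a * k₀) / 4 := by linarith
    _ = _ := by ring

theorem stepSize_rpow_half_le (hc : 0 < c₀) (hk : 0 < k₀) (hω : 0 ≤ ω) {t : ℕ} (ht : 0 < t) :
    stepSize c₀ k₀ ω t ^ (1 / 2 : ℝ) ≤ c₀ ^ (1 / 2 : ℝ) * (t : ℝ) ^ (-(ω / 2)) := by
  have ht' : (0 : ℝ) < t := by exact_mod_cast ht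
  have h1 : stepSize c₀ k₀ ω t ≤ c₀ * (t : ℝ) ^ (-ω) := by
    rw [Real.rpow_neg ht'.le, ← div_eq_mul_inv, stepSize]
    have : (t : ℝ) ≤ t + k₀ := by linarith
    gcongr
  refine (Real.rpow_le_rpow (stepSize_pos hc hk t).le h1 (by norm_num)).trans_eq ?_
  rw [Real.mul_rpow hc.le (by positivity), ← Real.rpow_mul ht'.le]
  congr 2
  ring

end StepSize

/-! ### From the moment of order `2p` to the moment of order `p` and the tail -/

section Moments

variable {Ω : Type*} [MeasurableSpace Ω] {ℙ : Measure Ω} [IsProbabilityMeasure ℙ] {f : Ω → ℝ}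
  {p q : ℝ}

theorem integral_rpow_le_of_two_mul (hf : ∀ x, 0 ≤ f x) (hq : 0 < q)
    (h1 : Integrable (fun x => f x ^ p) ℙ) (h2 : Integrable (fun x => f x ^ (2 * p)) ℙ)
    (h : ∫ x, f x ^ (2 * p) ∂ℙ ≤ q ^ (2 * p)) : ∫ x, f x ^ p ∂ℙ ≤ q ^ p := by
  have hqp : 0 < q ^ p := Real.rpow_pos_of_pos hq p
  have hsq : ∀ y : ℝ, 0 ≤ y → y ^ (2 * p) = (y ^ p) ^ 2 := fun y hy => by
    rw [mul_comm, Real.rpow_mul hy, Real.rpow_two]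
  -- Jensen for the square, in the form of integrating `(f ^ p - q ^ p) ^ 2 ≥ 0`.
  have hm : ∫ x, 2 * q ^ p * f x ^ p ∂ℙ ≤ ∫ x, (f x ^ (2 * p) + (q ^ p) ^ 2) ∂ℙ := by
    refine integral_mono (h1.const_mul _) (h2.add (integrable_const _)) fun x => ?_
    simp only
    rw [hsq _ (hf x)]
    linarith [sq_nonneg (f x ^ p - q ^ p)]
  rw [integral_const_mul, integral_add h2 (integrable_const _), integral_const, probReal_univ,
    one_smul] at hm
  rw [hsq q hq.le] at h
  have : q ^ p * ∫ x, f x ^ p ∂ℙ ≤ q ^ p * q ^ p := by linarith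
  exact le_of_mul_le_mul_left this hqp

theorem measureReal_exp_one_mul_le (hf : ∀ x, 0 ≤ f x) (hq : 0 < q) (hp : 0 < p)
    (h2 : Integrable (fun x => f x ^ (2 * p)) ℙ)
    (h : ∫ x, f x ^ (2 * p) ∂ℙ ≤ q ^ (2 * p)) :
    ℙ.real {x | Real.exp 1 * q ≤ f x} ≤ Real.exp (-(2 * p)) := by
  have hm := mul_meas_ge_le_integral_of_nonneg
    (Filter.Eventually.of_forall fun x => Real.rpow_nonneg (hf x) (2 * p)) h2
    ((Real.exp 1 * q) ^ (2 * p))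
  have hsub : ℙ.real {x | Real.exp 1 * q ≤ f x}
      ≤ ℙ.real {x | (Real.exp 1 * q) ^ (2 * p) ≤ f x ^ (2 * p)} :=
    measureReal_mono fun x hx => Real.rpow_le_rpow (by positivity) hx (by positivity)
  have hq2 : 0 < q ^ (2 * p) := Real.rpow_pos_of_pos hq _
  have he : (Real.exp 1 * q) ^ (2 * p) = Real.exp (2 * p) * q ^ (2 * p) := by
    rw [Real.mul_rpow (Real.exp_pos 1).le hq.le, Real.exp_one_rpow]
  refine hsub.trans ?_
  rw [Real.exp_neg, ← one_div, le_div_iff₀ (Real.exp_pos _)]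
  rw [he] at hm ⊢
  refine le_of_mul_le_mul_right (a := q ^ (2 * p)) ?_ hq2
  linarith

end Moments

/-! ### Matching the assumptions and constants with the abstract recursion -/

namespace Model

variable {S A : Type*} [Fintype S] [Fintype A] {d : ℕ} {M : Model S A d}

theorem Cxi_pos (θ : Param d) : 0 < M.Cxi θ := by linarith [M.eight_le_Cxi θ]

theorem CM_pos {θ₀ θs : Param d} {tmix : ℕ} {κ c₀ k₀ ω p : ℝ} (hτ : 0 < tmix) (hκ : 0 < κ) :
    0 < M.CM θ₀ θs tmix κ c₀ k₀ ω p := by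
  have h1 := M.Cxi_pos θs
  have h2 : (0 : ℝ) < tmix := by exact_mod_cast hτ
  have h3 : 0 < M.C1 θs tmix κ := by unfold C1; positivity
  exact h3.trans_le ((le_max_right _ _).trans (le_max_left _ _))

/-- Since `C₂` contains `C_ω ≥ 8α₀/κ`, the bound on `α₀` is quadratic in `p t_mix C_ξ α₀`; its
square root is the linear smallness that the block argument requires. -/
theorem StepCondition.small {θs : Param d} {tmix : ℕ} {κ c₀ k₀ ω p : ℝ} (hκ : 0 < κ) (hp : 0 < p)
    (h : M.StepCondition (1 / (2 * 10 ^ 9)) θs tmix κ c₀ k₀ ω p) :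
    p * (3 * tmix) * M.Cxi θs * stepSize c₀ k₀ ω 0 ≤ κ / 30000 := by
  obtain ⟨hc, hk, hω, h1, h2⟩ := h
  have hα := stepSize_pos (ω := ω) hc hk 0
  have hC := le_Comega hc hk hω hκ h1
  have hX := M.Cxi_pos θs
  set a := stepSize c₀ k₀ ω 0
  set X := M.Cxi θs
  have hmax : (0 : ℝ) < max (p ^ 2 * M.C2 θs tmix c₀ k₀ ω) 1 := lt_max_of_lt_right one_pos
  have h3 : a * (p ^ 2 * M.C2 θs tmix c₀ k₀ ω) ≤ 1 / (2 * 10 ^ 9) * κ := by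
    rw [← mul_div_assoc, le_div_iff₀ hmax] at h2
    exact (mul_le_mul_of_nonneg_left (le_max_left _ _) hα.le).trans h2
  have h4 : a * (p ^ 2 * ((tmix : ℝ) ^ 2 * X ^ 2 * (8 * a / κ)))
      ≤ a * (p ^ 2 * M.C2 θs tmix c₀ k₀ ω) := by
    unfold C2
    gcongr
  have h5 : (p * tmix * X * a) ^ 2 ≤ (κ / 90000) ^ 2 := by
    have h6 : a * (p ^ 2 * ((tmix : ℝ) ^ 2 * X ^ 2 * (8 * a / κ)))
        = 8 * (p * tmix * X * a) ^ 2 / κ := by ring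
    have h7 := h6 ▸ h4.trans h3
    rw [div_le_iff₀ hκ] at h7
    have := sq_nonneg κ
    rw [div_pow]
    linarith
  have h8 := le_of_sq_le_sq h5 (by positivity)
  linarith

theorem saSetup [DecidableEq S] [DecidableEq A] {μ : Obs S A → ℝ} {tmix : ℕ} {κ : ℝ}
    {θs : Param d} {c₀ k₀ ω p : ℝ} (hd : 0 < d) (hμ : IsStationary M.obsKernel μ)
    (hmix : IsUGE M.obsKernel μ tmix) (hκ : M.FeatureCondition μ κ)
    (hθ : M.SolvesProjectedBellman μ θs) (hp : 2 ≤ p)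
    (hα : M.StepCondition (1 / (2 * 10 ^ 9)) θs tmix κ c₀ k₀ ω p) :
    SASetup (fun x v => M.F (θs + x) v) M.obsKernel μ (fundamental M.obsKernel μ)
      (stepSize c₀ k₀ ω) √(M.Cxi θs) κ p tmix := by
  have hA : Nonempty A := by
    by_contra hne
    rw [not_nonempty_iff] at hne
    simpa using hμ.1.2
  have hω := hα.2.2.1
  refine
    { growth := fun x v => ?_
      lip := fun x y v => ?_
      drift := fun x => sum_inner_F_le hμ hκ hθ x
      K_nonneg := M.obsKernel_nonneg
      K_sum := M.sum_obsKernel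
      R_sum := hmix.sum_abs_fundamental_le
      poisson := hmix.sum_mul_fundamental M.sum_obsKernel
      one_le_b := (M.one_le_epsMax θs).trans (M.epsMax_le_sqrt_Cxi θs)
      κ_pos := hκ.1
      κ_le := hκ.le_one hμ.1 hd
      two_le_p := hp
      one_le_τ := hmix.1
      α_pos := stepSize_pos hα.1 hα.2.1
      α_anti := stepSize_antitone hα.1 hα.2.1 (by linarith [hω.1])
      α_sub := stepSize_sub_le hα.1 hα.2.1 hω.2.le hκ.1 hα.2.2.2.1
      α_small := ?_ }
  · have h1 := M.norm_F_le hκ.2.1 θs v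
    have h2 := M.norm_F_sub_le hκ.2.1 (θs + x) θs v
    rw [add_sub_cancel_left] at h2
    have h3 : ‖M.F (θs + x) v‖ ≤ ‖M.F θs v‖ + ‖M.F (θs + x) v - M.F θs v‖ := by
      simpa using norm_add_le (M.F θs v) (M.F (θs + x) v - M.F θs v)
    have h4 := mul_le_mul_of_nonneg_right (M.one_add_γ_le_sqrt_Cxi θs) (norm_nonneg x)
    linarith [M.epsMax_le_sqrt_Cxi θs]
  · have h2 := M.norm_F_sub_le hκ.2.1 (θs + x) (θs + y) v
    rw [add_sub_add_left_eq_sub] at h2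
    exact h2.trans (mul_le_mul_of_nonneg_right (M.one_add_γ_le_sqrt_Cxi θs) (norm_nonneg _))
  · rw [Real.sq_sqrt (M.Cxi_pos θs).le]
    exact hα.small hκ.1 (by linarith)

/-- The noise floor is absorbed by `C₁` and the initial error by the first entry of the maximum. The
factor `10 ^ 13` dominates `8 * (64 ^ 2 * 12000 ^ 2 + 8 ^ 2)`. -/
theorem sq_le_CM {θ₀ θs : Param d} {tmix : ℕ} {κ c₀ k₀ ω p : ℝ} (hp : 2 ≤ p)
    (hc : 0 < c₀) (hk : 0 < k₀) :
    (2 * (64 * level √(M.Cxi θs) κ p tmix + 8 * ‖θ₀ - θs‖ ^ 2 / stepSize c₀ k₀ ω 0)) ^ 2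
      ≤ 10 ^ 13 * M.CM θ₀ θs tmix κ c₀ k₀ ω p * p ^ 4 := by
  have hα := stepSize_pos (ω := ω) hc hk 0
  set a := stepSize c₀ k₀ ω 0 with ha
  set N := ‖θ₀ - θs‖
  have hp0 : 0 < p := by linarith
  have h1 : N ^ 4 / (p ^ 4 * a ^ 2) ≤ M.CM θ₀ θs tmix κ c₀ k₀ ω p :=
    (le_max_left _ _).trans (le_max_left _ _)
  have h2 : M.C1 θs tmix κ ≤ M.CM θ₀ θs tmix κ c₀ k₀ ω p :=
    (le_max_right _ _).trans (le_max_left _ _)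
  set B := M.CM θ₀ θs tmix κ c₀ k₀ ω p
  have e1 : level √(M.Cxi θs) κ p tmix ^ 2 ≤ 12000 ^ 2 * (B * p ^ 4) := by
    have e : level √(M.Cxi θs) κ p tmix ^ 2 = 12000 ^ 2 * (M.C1 θs tmix κ * p ^ 2) := by
      rw [level, Real.sq_sqrt (M.Cxi_pos θs).le, C1]
      ring
    have h0 : 0 ≤ M.C1 θs tmix κ := by unfold C1; positivity
    have hpp : p ^ 2 ≤ p ^ 4 := pow_le_pow_right₀ (by linarith) (by norm_num)
    rw [e]
    exact mul_le_mul_of_nonneg_left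
      (mul_le_mul h2 hpp (by positivity) (h0.trans h2)) (by norm_num)
  have e2 : (N ^ 2 / a) ^ 2 ≤ B * p ^ 4 := by
    calc (N ^ 2 / a) ^ 2 = N ^ 4 / (p ^ 4 * a ^ 2) * p ^ 4 := by field_simp
      _ ≤ _ := mul_le_mul_of_nonneg_right h1 (by positivity)
  have e3 : (64 * level √(M.Cxi θs) κ p tmix + 8 * (N ^ 2 / a)) ^ 2
      ≤ 2 * ((64 * level √(M.Cxi θs) κ p tmix) ^ 2 + (8 * (N ^ 2 / a)) ^ 2) := add_sq_le
  rw [mul_div_assoc 8]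
  have := sq_nonneg (N ^ 2 / a)
  linarith

end Model
end SoftQ

/-! ### The main theorem -/

theorem theorem1 :
    ∃ c C : ℝ, 0 < c ∧ 0 < C ∧
      ∀ (S A : Type*) [Fintype S] [Fintype A] [DecidableEq S] [DecidableEq A] (d : ℕ)
        (M : SoftQ.Model S A d) (μ : SoftQ.Obs S A → ℝ) (tmix : ℕ) (κ : ℝ)
        (θ₀ θs : SoftQ.Param d) (c₀ k₀ ω p : ℝ)
        (Ω : Type*) [MeasurableSpace Ω] (ℙ : MeasureTheory.Measure Ω)
        [MeasureTheory.IsProbabilityMeasure ℙ] (z : ℕ → Ω → SoftQ.Obs S A),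
        SoftQ.IsStationary M.obsKernel μ →
        SoftQ.IsUGE M.obsKernel μ tmix →
        SoftQ.IsMarkovChain ℙ μ M.obsKernel z →
        M.FeatureCondition μ κ →
        M.SolvesProjectedBellman μ θs →
        2 ≤ p →
        M.StepCondition c θs tmix κ c₀ k₀ ω p →
        ∀ t : ℕ, 0 < t →
          let α : ℕ → ℝ := SoftQ.stepSize c₀ k₀ ω
          let CM : ℝ := C * M.CM θ₀ θs tmix κ c₀ k₀ ω p
          let err : Ω → ℝ := fun x => ‖M.iterate α θ₀ (fun j => z j x) (t + 1) - θs‖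
          MeasureTheory.Integrable (fun x => err x ^ (2 * p)) ℙ ∧
          (∫ x, err x ^ (2 * p) ∂ℙ) ^ (2 / p) ≤ CM * p ^ 4 * α t ^ 2 ∧
          (∫ x, err x ^ p ∂ℙ) ^ (1 / p)
            ≤ CM ^ (1 / 4 : ℝ) * c₀ ^ (1 / 2 : ℝ) * p * (t : ℝ) ^ (-(ω / 2)) ∧
          ℙ.real {x | Real.exp 1 * (CM ^ (1 / 4 : ℝ) * p * α t ^ (1 / 2 : ℝ)) ≤ err x}
            ≤ Real.exp (-(2 * p)) := by
  refine ⟨1 / (2 * 10 ^ 9), 10 ^ 13, by norm_num, by norm_num, ?_⟩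
  intro S A _ _ _ _ d M μ tmix κ θ₀ θs c₀ k₀ ω p Ω _ ℙ _ z hμ hmix hz hκ hθ hp hα t ht α CM err
  have hp0 : 0 < p := by linarith
  have hα0 : ∀ n, 0 < α n := SoftQ.stepSize_pos hα.1 hα.2.1
  have hCM : 0 < CM := mul_pos (by norm_num) (SoftQ.Model.CM_pos hmix.1 hκ.1)
  let X : ℕ → Ω → SoftQ.Param d := fun n x => M.iterate α θ₀ (fun j => z j x) n - θs
  have hX0 : ∀ x, X 0 x = θ₀ - θs := fun _ => rfl
  have hX : ∀ n x, X (n + 1) x = X n x + α n • M.F (θs + X n x) (z n x) := by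
    intro n x
    simp only [X, SoftQ.Model.iterate, add_sub_cancel]
    abel
  have hint : ∀ g : ℝ → ℝ, MeasureTheory.Integrable (fun x => g (err x)) ℙ := fun g =>
    hz.integrable ((SoftQ.SASetup.past_iterate (F := fun x v => M.F (θs + x) v) hX0 hX
      (le_refl (t + 1))).comp fun x => g ‖x‖)
  have herr : ∀ x, 0 ≤ err x := fun _ => norm_nonneg _
  have hint2 := hint fun y => y ^ (2 * p)
  set q := CM ^ (1 / 4 : ℝ) * p * α t ^ (1 / 2 : ℝ) with hq
  have hq0 : 0 < q := mul_pos (mul_pos (Real.rpow_pos_of_pos hCM _) hp0)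
    (Real.rpow_pos_of_pos (hα0 t) _)
  have hq4 : q ^ 4 = CM * p ^ 4 * α t ^ 2 := by
    rw [hq, mul_pow, mul_pow, ← Real.rpow_mul_natCast hCM.le, ← Real.rpow_mul_natCast (hα0 t).le]
    norm_num
  have hmain : ∫ x, err x ^ (2 * p) ∂ℙ ≤ q ^ (2 * p) := by
    -- In dimension `0` the error vanishes; the case is separate because `κ ≤ 1` needs a nonzero
    -- vector.
    rcases Nat.eq_zero_or_pos d with rfl | hd
    · have h0 : ∀ x, err x = 0 := fun x => by
        simp [err, Subsingleton.elim (M.iterate α θ₀ (fun j => z j x) (t + 1)) θs]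
      simp only [h0, Real.zero_rpow (by positivity : (2 * p) ≠ 0), MeasureTheory.integral_zero]
      positivity
    · have hs := SoftQ.Model.saSetup hd hμ hmix hκ hθ hp hα
      set D := 64 * SoftQ.level √(M.Cxi θs) κ p tmix + 8 * ‖θ₀ - θs‖ ^ 2 / α 0 with hD
      have hL := hs.level_pos
      have hN : 0 ≤ 8 * ‖θ₀ - θs‖ ^ 2 / α 0 := div_nonneg (by positivity) (hα0 0).le
      have hD0 : 0 < D := by linarith
      have hb := hs.integral_lyapunov_rpow_le (D := D) hz hX0 hX (by linarith) (by
        have : 8 * ‖θ₀ - θs‖ ^ 2 = 8 * ‖θ₀ - θs‖ ^ 2 / α 0 * α 0 :=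
          (div_mul_cancel₀ _ (hα0 0).ne').symm
        have h2 := mul_pos hL (hα0 0)
        change 8 * ‖θ₀ - θs‖ ^ 2 ≤ D * α 0
        rw [hD, add_mul]
        linarith) (t + 1)
      -- The factor `2` comes from `err² ≤ 2 Y`, the lower comparison in `lyapunov_bounds`.
      have hDq : 2 * (D * α (t + 1)) ≤ q ^ 2 := by
        have h1 : 2 * (D * α (t + 1)) ≤ 2 * D * α t := by
          have := mul_le_mul_of_nonneg_left (hs.α_anti (Nat.le_succ t)) hD0.le
          change D * α (t + 1) ≤ D * α t at this
          linarith
        refine h1.trans (le_of_sq_le_sq ?_ (by positivity))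
        rw [← pow_mul, hq4, mul_pow]
        exact mul_le_mul_of_nonneg_right (SoftQ.Model.sq_le_CM hp hα.1 hα.2.1) (sq_nonneg _)
      have hpt : ∀ x, err x ^ (2 * p) ≤ 2 ^ p * SoftQ.lyapunov (fun x v => M.F (θs + x) v)
          (SoftQ.fundamental M.obsKernel μ) (SoftQ.level √(M.Cxi θs) κ p tmix) α (t + 1)
          (X (t + 1) x) (z (t + 1) x) ^ p := fun x => by
        have h1 := (hs.lyapunov_bounds (t + 1) (X (t + 1) x) (z (t + 1) x)).1
        have h2 := mul_pos hL (hs.α_pos (t + 1))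
        have h3 := hs.lyapunov_pos (t + 1) (X (t + 1) x) (z (t + 1) x)
        rw [← Real.mul_rpow two_pos.le h3.le, Real.rpow_mul (herr x), Real.rpow_two]
        refine Real.rpow_le_rpow (sq_nonneg _) ?_ hp0.le
        change ‖X (t + 1) x‖ ^ 2 ≤ _
        linarith
      have hi := hz.integrable (n := t + 1)
        (((SoftQ.SASetup.past_lyapunov (F := fun x v => M.F (θs + x) v) hX0 hX
          (R := SoftQ.fundamental M.obsKernel μ) (SoftQ.level √(M.Cxi θs) κ p tmix)
          (le_refl (t + 1))).comp fun y => 2 ^ p * y ^ p))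
      refine (MeasureTheory.integral_mono hint2 hi hpt).trans ?_
      rw [MeasureTheory.integral_const_mul]
      refine (mul_le_mul_of_nonneg_left hb (by positivity)).trans ?_
      have hDa := (mul_pos hD0 (hα0 (t + 1))).le
      rw [Real.rpow_mul hq0.le, Real.rpow_two]
      exact (Real.mul_rpow two_pos.le hDa).symm.trans_le
        (Real.rpow_le_rpow (by positivity) hDq hp0.le)
  refine ⟨hint2, ?_, ?_, SoftQ.measureReal_exp_one_mul_le herr hq0 hp0 hint2 hmain⟩
  · rw [← hq4]
    have h0 : 0 ≤ ∫ x, err x ^ (2 * p) ∂ℙ :=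
      MeasureTheory.integral_nonneg fun x => Real.rpow_nonneg (herr x) _
    refine (Real.rpow_le_rpow h0 hmain (by positivity)).trans_eq ?_
    rw [← Real.rpow_mul hq0.le, show 2 * p * (2 / p) = ((4 : ℕ) : ℝ) by field_simp; norm_num,
      Real.rpow_natCast]
  · have h0 : 0 ≤ ∫ x, err x ^ p ∂ℙ :=
      MeasureTheory.integral_nonneg fun x => Real.rpow_nonneg (herr x) _
    have h1 := SoftQ.integral_rpow_le_of_two_mul herr hq0 (hint fun y => y ^ p) hint2 hmain
    have h2 := Real.rpow_le_rpow h0 h1 (by positivity : 0 ≤ 1 / p)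
    rw [← Real.rpow_mul hq0.le, mul_one_div_cancel hp0.ne', Real.rpow_one] at h2
    refine h2.trans ?_
    have h3 := SoftQ.stepSize_rpow_half_le hα.1 hα.2.1 (by linarith [hα.2.2.1.1] : 0 ≤ ω) ht
    calc q ≤ CM ^ (1 / 4 : ℝ) * p * (c₀ ^ (1 / 2 : ℝ) * (t : ℝ) ^ (-(ω / 2))) :=
          mul_le_mul_of_nonneg_left h3 (by positivity)
      _ = _ := by ring
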